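/- **Setting.** Let $d \ge 2$ and let $\mathbb{R}^{n_1 \times \dots \times n_d}$ carry the Frobenius inner product. For a tensor $X$ let $X^{\langle k \rangle}$, $1 \le k \le d-1$, be its $k$-th unfolding, a matrix of size $(n_1 \cdots n_k) \times (n_{k+1} \cdots n_d)$. The TT-rank of $X$ is $(\operatorname{rank} X^{\langle 1 \rangle}, \dots, \operatorname{rank} X^{\langle d-1 \rangle})$. Fix $\mathbf{r} = (r_1, \dots, r_{d-1})$ with all $r_k \ge 1$, and let $\mathcal{M}_{\mathbf{r}}$ be the smooth embedded submanifold of tensors of TT-rank exactly $\mathbf{r}$. For $X \in \mathcal{M}_{\mathbf{r}}$ let $\mathcal{P}_X$ be the orthogonal projection onto the tangent space $T_X \mathcal{M}_{\mathbf{r}}$. Put $$\sigma_{\min}(X) = \Bigl( \sum_{k=1}^{d-1} \frac{1}{\sigma_{\min}(X^{\langle k \rangle})} \Bigr)^{-1},$$ where $\sigma_{\min}$ of a matrix is its smallest positive singular value. Let $\mathrm{TT\text{-}SVD}_{\mathbf{r}}$ be the TT-SVD algorithm truncated to TT-rank $\mathbf{r}$ (it processes the modes from left to right: the current remainder is reshaped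 into a matrix, its singular value decomposition is truncated to rank $r_k$, the left factor becomes the $k$-th TT-core and the product of the two other factors the next remainder; the last remainder is the last TT-core). Where singular value decompositions are not unique, any choice is allowed. A linear operator $\mathcal{R} : \mathbb{R}^{n_1 \times \dots \times n_d} \to \mathbb{R}^s$ satisfies RIP of order $\mathbf{r}$ with constant $\delta$ if $0 < \delta < 1$ and $(1 - \delta) \|X\|_F^2 \le \|\mathcal{R} X\|_F^2 \le (1 + \delta) \|X\|_F^2$ for all tensors $X$ of TT-rank at most $\mathbf{r}$ (entrywise). One step of Riemannian gradient descent (RGD) for the recovery of $A$ from $\mathcal{R} A$ takes $X_t \in \mathcal{M}_{\mathbf{r}}$ to $$X_{t+1} = \mathrm{TT\text{-}SVD}_{\mathbf{r}}(X_t - \alpha_t Y_t), \qquad Y_t = \mathcal{P}_{X_t} \mathcal{R}^* (\mathcal{R} X_t - \mathcal{R} A), \qquad \alpha_t = \frac{\|Y_t\|_F^2}{\|\mathcal{R} Y_t\|_F^2}$$ (with $\alpha_t = 0$ if $Y_t = 0$). **Theorem.** Let $A \in \mathcal{M}_{\mathbf{r}}$, let $\mathcal{R}$ satisfy RIP of order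 $2\mathbf{r}$ with constant $\delta_{2\mathbf{r}}$, and let $\|\mathcal{R}^* \mathcal{R}\| \le C$ in the operator norm. 1. If $X_t \in \mathcal{M}_{\mathbf{r}}$ and $X_{t+1}$ is obtained from $X_t$ by one step of RGD, then $\|X_{t+1} - A\|_F \le \beta_t \|X_t - A\|_F$ with $$\beta_t = (1 + \sqrt{d-1}) \left[ \frac{2 \delta_{2\mathbf{r}}}{1 - \delta_{2\mathbf{r}}} + \left( 1 + \frac{C}{1 - \delta_{2\mathbf{r}}} \right) \frac{\|X_t - A\|_F}{\sigma_{\min}(A)} \right].$$ 2. If $\delta_{2\mathbf{r}} < (3 + 2\sqrt{d-1})^{-1}$ and $X_0 \in \mathcal{M}_{\mathbf{r}}$ satisfies $$\frac{\|X_0 - A\|_F}{\sigma_{\min}(A)} < \frac{1}{1 + C - \delta_{2\mathbf{r}}} \left( \frac{1 - \delta_{2\mathbf{r}}}{1 + \sqrt{d-1}} - 2\delta_{2\mathbf{r}} \right),$$ then $\beta_0 < 1$, and every sequence $X_0, X_1, X_2, \dots$ in $\mathcal{M}_{\mathbf{r}}$ generated by RGD satisfies, for all $t \ge 0$, $$\|X_{t+1}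 - A\|_F \le \beta_0^{t+1} \|X_0 - A\|_F,$$ with strict inequality if $X_0 \ne A$. 3. If, instead of the bound $\|\mathcal{R}^* \mathcal{R}\| \le C$, the operator $\mathcal{R}$ satisfies RIP of order $3\mathbf{r}$ with constant $\delta_{3\mathbf{r}}$ (in addition to RIP of order $2\mathbf{r}$ with constant $\delta_{2\mathbf{r}}$), then 1 and 2 hold with $C$ replaced by $1 + \delta_{3\mathbf{r}}$. -/

import Mathlib

open scoped ContDiff

noncomputable section

namespace TensorTrain

/-- Real tensors of order `d = m + 1` and size `n 0 × ⋯ × n m`; the norm of `EuclideanSpace` is the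
Frobenius norm. -/
abbrev Tensor {m : ℕ} (n : Fin (m + 1) → ℕ) : Type :=
  EuclideanSpace ℝ ((i : Fin (m + 1)) → Fin (n i))

/-- The unfolding of a tensor of order `m + 1` that separates the modes `0, …, k` (row multi-index)
from the modes `k + 1, …, m` (column multi-index). With modes counted from one this is the
unfolding number `k + 1`, and the cuts `k : Fin m` are exactly the unfoldings `1, …, d - 1`. -/
def unfolding {m : ℕ} {n : Fin (m + 1) → ℕ} (k : Fin m) (X : Tensor n) :
    Matrix ((i : {i : Fin (m + 1) // i ≤ k.castSucc}) → Fin (n i))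
      ((i : {i : Fin (m + 1) // ¬ i ≤ k.castSucc}) → Fin (n i)) ℝ :=
  Matrix.of fun a b =>
    X ((Equiv.piEquivPiSubtypeProd (fun i => i ≤ k.castSucc) (fun i => Fin (n i))).symm (a, b))

/-- The set of tensors of TT-rank exactly `r`. -/
def fixedRank {m : ℕ} (n : Fin (m + 1) → ℕ) (r : Fin m → ℕ) : Set (Tensor n) :=
  {X | ∀ k, (unfolding k X).rank = r k}

/-- The smallest positive singular value of a matrix. -/
def matrixSigmaMin {I J : Type*} [Fintype I] [Fintype J] [DecidableEq J]
    (M : Matrix I J ℝ) : ℝ :=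
  sInf {s : ℝ | 0 < s ∧ ∃ i : ℕ, s = (Matrix.toEuclideanLin M).singularValues i}

/-- `(∑ₖ 1 / σ_min(X^⟨k⟩))⁻¹`, where `k` runs over all unfoldings. -/
def sigmaMin {m : ℕ} {n : Fin (m + 1) → ℕ} (X : Tensor n) : ℝ :=
  (∑ k : Fin m, 1 / matrixSigmaMin (unfolding k X))⁻¹

/-- `v` is the velocity at `X` of a smooth curve that stays in `S`. -/
def IsVelocity {E : Type*} [NormedAddCommGroup E] [NormedSpace ℝ E] (S : Set E) (X v : E) : Prop :=
  ∃ (ε : ℝ) (γ : ℝ → E), 0 < ε ∧ ContDiffOn ℝ ∞ γ (Set.Ioo (-ε) ε) ∧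
    (∀ t ∈ Set.Ioo (-ε) ε, γ t ∈ S) ∧ γ 0 = X ∧ HasDerivAt γ v 0

/-- The tangent space at `X` of the manifold of tensors of TT-rank `r`. At a point of this embedded
submanifold the velocities of smooth curves already form a linear subspace; the span only makes
it a `Submodule`. -/
def tangentSpace {m : ℕ} {n : Fin (m + 1) → ℕ} (r : Fin m → ℕ) (X : Tensor n) :
    Submodule ℝ (Tensor n) :=
  Submodule.span ℝ {v | IsVelocity (fixedRank n r) X v}

/-- The restricted isometry property of order `r` with constant `δ`. -/
def HasRIP {m : ℕ} {n : Fin (m + 1) → ℕ} {s : ℕ} (R : Tensor n →L[ℝ] EuclideanSpace ℝ (Fin s))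
    (r : Fin m → ℕ) (δ : ℝ) : Prop :=
  0 < δ ∧ δ < 1 ∧ ∀ X : Tensor n, (∀ k, (unfolding k X).rank ≤ r k) →
    (1 - δ) * ‖X‖ ^ 2 ≤ ‖R X‖ ^ 2 ∧ ‖R X‖ ^ 2 ≤ (1 + δ) * ‖X‖ ^ 2

/-- The pair `U`, `C = ΣVᵀ` comes from a singular value decomposition of `M` (possibly with some
zero singular values) that is truncated after the `p` largest singular values. -/
def IsTruncatedSVD {I J : Type*} [Fintype I] [Fintype J] {p : ℕ}
    (M : Matrix I J ℝ) (U : Matrix I (Fin p) ℝ) (C : Matrix (Fin p) J ℝ) : Prop :=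
  ∃ (q : ℕ) (hpq : p ≤ q) (u : Matrix I (Fin q) ℝ) (σ : Fin q → ℝ) (v : Matrix J (Fin q) ℝ),
    u.transpose * u = 1 ∧ v.transpose * v = 1 ∧ (∀ i, 0 ≤ σ i) ∧ Antitone σ ∧
    M = u * Matrix.diagonal σ * v.transpose ∧
    U = u.submatrix id (Fin.castLE hpq) ∧
    C = (Matrix.diagonal σ * v.transpose).submatrix (Fin.castLE hpq) id

/-- The truncated TT-SVD algorithm, sweeping from left to right. The current remainder `C` is a
`p × n 0 × ⋯ × n m` tensor. As long as at least two modes are left, `C` is reshaped into a matrix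
of size `(p * n 0) × (n 1 ⋯ n m)`, its SVD is truncated to rank `r 0`, the left factor `U` becomes
the next TT-core and the algorithm continues with the right factor `C'`; the last remainder is the
last TT-core. `Z` is the contraction of the TT-cores found. As the SVD need not be unique, this is
a relation between the input `C` and the possible outputs `Z`. -/
def IsTTSVDFrom : {m : ℕ} → {n : Fin (m + 1) → ℕ} → (r : Fin m → ℕ) → {p : ℕ} →
    (C Z : Fin p → ((i : Fin (m + 1)) → Fin (n i)) → ℝ) → Prop
  | 0, _, _, _, C, Z => Z = C
  | m + 1, n, r, p, C, Z =>
    ∃ (U : Matrix (Fin p × Fin (n 0)) (Fin (r 0)) ℝ)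
      (C' Z' : Fin (r 0) → ((i : Fin (m + 1)) → Fin (n i.succ)) → ℝ),
      IsTruncatedSVD
        (Matrix.of fun (a : Fin p × Fin (n 0)) (j : (i : Fin (m + 1)) → Fin (n i.succ)) =>
          C a.1 (Fin.cons (α := fun i => Fin (n i)) a.2 j))
        U (Matrix.of C') ∧
      IsTTSVDFrom (n := fun i => n i.succ) (fun k => r k.succ) C' Z' ∧
      ∀ a i, Z a i = ∑ b, U (a, i 0) b * Z' b (fun l => i l.succ)

/-- `Z` is an output of the TT-SVD of `Y` truncated to the TT-rank `r`. -/
def IsTTSVD {m : ℕ} {n : Fin (m + 1) → ℕ} (r : Fin m → ℕ) (Y Z : Tensor n) : Prop :=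
  IsTTSVDFrom r (fun _ : Fin 1 => fun i => Y i) (fun _ : Fin 1 => fun i => Z i)

section RGD

variable {m : ℕ} {n : Fin (m + 1) → ℕ} {s : ℕ}
  (R : Tensor n →L[ℝ] EuclideanSpace ℝ (Fin s)) (r : Fin m → ℕ) (A X : Tensor n)

/-- The Riemannian gradient `P_X R* (R X - R A)`. -/
def riemannianGradient : Tensor n :=
  (tangentSpace r X).starProjection (ContinuousLinearMap.adjoint R (R X - R A))

/-- The exact line search step size `‖Y‖² / ‖R Y‖²`, with `Y` the Riemannian gradient (and `0` if
`Y = 0`). -/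
def stepSize : ℝ :=
  ‖riemannianGradient R r A X‖ ^ 2 / ‖R (riemannianGradient R r A X)‖ ^ 2

/-- `X'` results from one step of Riemannian gradient descent at `X`, for the recovery of `A` from
the measurements `R A`. -/
def IsRGDStep (X' : Tensor n) : Prop :=
  IsTTSVD r (X - stepSize R r A X • riemannianGradient R r A X) X'

/-- The contraction factor `(1 + √(d - 1)) [2δ / (1 - δ) + (1 + C / (1 - δ)) ‖X - A‖ / σ_min(A)]`
for tensors of order `d = m + 1`. -/
def contractionFactor (δ C : ℝ) : ℝ :=
  (1 + √(m : ℝ)) * (2 * δ / (1 - δ) + (1 + C / (1 - δ)) * (‖X - A‖ / sigmaMin A))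

end RGD

end TensorTrain

end

/-! Put `e = X - A` and let `P` be the orthogonal projection onto the tangent space at `X`. The
error after the gradient step, `e - α Y`, splits into the orthogonal parts `(I - P) e` and `P e - α
Y`. Since `X` is itself a tangent vector, the normal part is `-(I - P) A`, and the curvature
estimate `norm_sub_starProjection_tangentSpace_le` makes it quadratically small: at most `‖e‖² /
σ_min(A)`.

Tangent vectors have TT-rank at most `2r`. Hence RIP puts `α` between `1 / (1 + δ)` and `1 / (1 -
δ)` and bounds the form of `I - α R* R` on the tangent space by `2δ / (1 - δ)`. The normal part
enters the tangential one only through `α P R* R`, which costs `C / (1 - δ)`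
(`norm_sub_lineSearch_sq_le`). Here `C` comes from the operator norm, or from RIP of order `3r`,
because `(I - P) A` has TT-rank at most `3r`. Finally TT-SVD is quasi-optimal with constant `√(d -
1)` (`IsTTSVD.norm_sub_le`), and the triangle inequality yields the factor `1 + √(d - 1)`. The
initial condition is `β₀ < 1` rearranged, and `β` is monotone in the error, so the one-step bound
iterates.

The manifold enters only through ranks. Velocities annihilate pairs of left and right kernel
vectors, which bounds their rank; a line `X + t W` along which no unfolding rank exceeds `r` stays
in the manifold for small `t`, because rank is lower semicontinuous. The curvature estimate
telescopes `A` along the nested column projections of the unfoldings of `X`, and each summand has an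
explicit tangent approximation. -/

noncomputable section

namespace TensorTrain

set_option linter.unusedSectionVars false

/-! ### Frobenius norms, orthogonal projections and the smallest positive singular value -/

section Matrices

open Matrix

variable {I J : Type*} [Fintype I] [Fintype J]

/-- The square of the Frobenius norm of a matrix. -/
def frobSq (M : Matrix I J ℝ) : ℝ := ∑ i, ∑ j, M i j ^ 2

theorem frobSq_nonneg (M : Matrix I J ℝ) : 0 ≤ frobSq M :=
  Finset.sum_nonneg fun _ _ => Finset.sum_nonneg fun _ _ => sq_nonneg _

theorem frobSq_transpose (M : Matrix I J ℝ) : frobSq Mᵀ = frobSq M :=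
  Finset.sum_comm

theorem frobSq_eq_sum_col (M : Matrix I J ℝ) :
    frobSq M = ∑ j, (fun i => M i j) ⬝ᵥ (fun i => M i j) := by
  rw [frobSq, Finset.sum_comm]
  simp [dotProduct, sq]

theorem frobSq_eq_trace (M : Matrix I J ℝ) : frobSq M = (Mᵀ * M).trace := by
  rw [frobSq_eq_sum_col]
  rfl

theorem frobSq_eq_trace' (M : Matrix I J ℝ) : frobSq M = (M * Mᵀ).trace := by
  rw [frobSq_eq_trace, trace_mul_comm]

theorem dotProduct_mulVec_self_le (M : Matrix I J ℝ) (v : J → ℝ) :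
    (M *ᵥ v) ⬝ᵥ (M *ᵥ v) ≤ frobSq M * (v ⬝ᵥ v) := by
  rw [frobSq, Finset.sum_mul]
  refine Finset.sum_le_sum fun i _ => ?_
  have := Finset.sum_mul_sq_le_sq_mul_sq Finset.univ (fun j => M i j) v
  simpa [mulVec, dotProduct, sq] using this

/-- `S` is the matrix of an orthogonal projection. -/
def IsOrthProj (S : Matrix I I ℝ) : Prop := Sᵀ = S ∧ S * S = S

theorem IsOrthProj.one_sub [DecidableEq I] {S : Matrix I I ℝ} (hS : IsOrthProj S) :
    IsOrthProj (1 - S) := by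
  refine ⟨by simp [hS.1], ?_⟩
  rw [mul_sub, sub_mul, sub_mul, hS.2]
  simp

theorem IsOrthProj.dotProduct_mulVec {S : Matrix I I ℝ} (hS : IsOrthProj S) (v : I → ℝ) :
    (S *ᵥ v) ⬝ᵥ (S *ᵥ v) = v ⬝ᵥ (S *ᵥ v) := by
  rw [Matrix.dotProduct_mulVec, ← mulVec_transpose, hS.1, mulVec_mulVec, hS.2, dotProduct_comm]

theorem IsOrthProj.dotProduct_le {S : Matrix I I ℝ} (hS : IsOrthProj S) (v : I → ℝ) :
    (S *ᵥ v) ⬝ᵥ (S *ᵥ v) ≤ v ⬝ᵥ v := by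
  have h1 := hS.dotProduct_mulVec v
  have h2 : 0 ≤ (v - S *ᵥ v) ⬝ᵥ (v - S *ᵥ v) := by
    simpa using dotProduct_star_self_nonneg (v - S *ᵥ v)
  simp only [sub_dotProduct, dotProduct_sub] at h2
  rw [dotProduct_comm (S *ᵥ v) v] at h2
  linarith

theorem IsOrthProj.frobSq_mul_le {S : Matrix I I ℝ} (hS : IsOrthProj S) (M : Matrix I J ℝ) :
    frobSq (S * M) ≤ frobSq M := by
  rw [frobSq_eq_sum_col, frobSq_eq_sum_col]
  exact Finset.sum_le_sum fun j _ => hS.dotProduct_le fun i => M i j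

theorem IsOrthProj.frobSq_mul_le' {S : Matrix J J ℝ} (hS : IsOrthProj S) (M : Matrix I J ℝ) :
    frobSq (M * S) ≤ frobSq M := by
  rw [← frobSq_transpose, transpose_mul, hS.1, ← frobSq_transpose M]
  exact hS.frobSq_mul_le _

theorem finrank_range_add_finrank_ker_mulVecLin (M : Matrix I J ℝ) :
    M.rank + Module.finrank ℝ M.mulVecLin.ker = Fintype.card J := by
  have := M.mulVecLin.finrank_range_add_finrank_ker
  rwa [Module.finrank_fintype_fun_eq_card] at this

theorem rank_le_of_mulVec_eq_zero {L : Type*} [Fintype L] {M : Matrix I J ℝ} {N : Matrix L J ℝ}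
    (h : ∀ w, M *ᵥ w = 0 → N *ᵥ w = 0) : N.rank ≤ M.rank := by
  have h1 := finrank_range_add_finrank_ker_mulVecLin M
  have h2 := finrank_range_add_finrank_ker_mulVecLin N
  have h3 : M.mulVecLin.ker ≤ N.mulVecLin.ker := fun w hw => h w hw
  have := Submodule.finrank_mono h3
  omega

theorem rank_le_of_vecMul_eq_zero {L : Type*} [Fintype L] {M : Matrix I J ℝ} {N : Matrix I L ℝ}
    (h : ∀ u, u ᵥ* M = 0 → u ᵥ* N = 0) : N.rank ≤ M.rank := by
  rw [← rank_transpose N, ← rank_transpose M]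
  refine rank_le_of_mulVec_eq_zero fun w hw => ?_
  rw [mulVec_transpose] at hw ⊢
  exact h w hw

theorem rank_add_le (M N : Matrix I J ℝ) : (M + N).rank ≤ M.rank + N.rank := by
  unfold Matrix.rank
  rw [mulVecLin_add]
  exact (Submodule.finrank_mono (LinearMap.range_add_le _ _)).trans
    (Submodule.finrank_add_le_finrank_add_finrank _ _)

/-- `S` is the matrix of the orthogonal projection onto the column space of `M`. -/
def IsColProj (M : Matrix I J ℝ) (S : Matrix I I ℝ) : Prop :=
  IsOrthProj S ∧ S * M = M ∧ ∀ u, u ᵥ* M = 0 → u ᵥ* S = 0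

/-- `Q` is the matrix of the orthogonal projection onto the row space of `M`. -/
def IsRowProj (M : Matrix I J ℝ) (Q : Matrix J J ℝ) : Prop :=
  IsOrthProj Q ∧ M * Q = M ∧ ∀ w, M *ᵥ w = 0 → Q *ᵥ w = 0

theorem exists_isRowProj [DecidableEq J] (M : Matrix I J ℝ) : ∃ Q, IsRowProj M Q := by
  let T := Matrix.toEuclideanLin M
  let P : EuclideanSpace ℝ J →ₗ[ℝ] EuclideanSpace ℝ J := (T.kerᗮ).starProjection
  have hP : Matrix.toEuclideanLin (Matrix.toEuclideanLin.symm P) = P :=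
    LinearEquiv.apply_symm_apply _ _
  set Q : Matrix J J ℝ := Matrix.toEuclideanLin.symm P with hQ
  have hQv : ∀ w, Q *ᵥ w = (P (WithLp.toLp 2 w)).ofLp := fun w => by
    rw [← hP, Matrix.toLpLin_toLp]; rfl
  refine ⟨Q, ⟨?_, ?_⟩, ?_, ?_⟩
  · have : Q.IsHermitian := by
      rw [← Matrix.isSymmetric_toEuclideanLin_iff, hP]
      exact Submodule.starProjection_isSymmetric _
    simpa [Matrix.IsHermitian, conjTranspose_eq_transpose_of_trivial] using this
  · refine Matrix.ext_of_mulVec_single fun i => ?_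
    rw [← mulVec_mulVec, hQv, hQv]
    simp only [WithLp.toLp_ofLp]
    congr 1
    exact Submodule.starProjection_eq_self_iff.2 (Submodule.starProjection_apply_mem _ _)
  · refine Matrix.ext_of_mulVec_single fun i => ?_
    rw [← mulVec_mulVec, hQv]
    have h1 := Submodule.sub_starProjection_mem_orthogonal (K := T.kerᗮ)
      (WithLp.toLp 2 (Pi.single i (1 : ℝ)))
    rw [Submodule.orthogonal_orthogonal, LinearMap.mem_ker, map_sub, sub_eq_zero] at h1
    have h2 := congrArg WithLp.ofLp h1
    simp only [T, Matrix.toLpLin_apply] at h2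
    exact h2.symm
  · intro w hw
    rw [hQv]
    have h1 : WithLp.toLp 2 w ∈ T.ker := by
      rw [LinearMap.mem_ker]
      simp [T, Matrix.toLpLin_apply, hw]
    have h2 : P (WithLp.toLp 2 w) = 0 := by
      refine (Submodule.starProjection_apply_eq_zero_iff _).2 ?_
      rwa [Submodule.orthogonal_orthogonal]
    rw [h2]; rfl

theorem exists_isColProj [DecidableEq I] (M : Matrix I J ℝ) : ∃ S, IsColProj M S := by
  obtain ⟨Q, hQ, h1, h2⟩ := exists_isRowProj Mᵀ
  refine ⟨Q, hQ, ?_, fun u hu => ?_⟩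
  · rw [← transpose_inj, transpose_mul, hQ.1, h1]
  · rw [← mulVec_transpose, hQ.1]
    exact h2 u (by rw [mulVec_transpose, hu])

theorem IsRowProj.mul_eq {L : Type*} [Fintype L] {M : Matrix I J ℝ} {Q : Matrix J J ℝ}
    (hQ : IsRowProj M Q) {N : Matrix L J ℝ} (h : ∀ w, M *ᵥ w = 0 → N *ᵥ w = 0) : N * Q = N := by
  classical
  refine Matrix.ext_of_mulVec_single fun i => ?_
  rw [← mulVec_mulVec, eq_comm, ← sub_eq_zero, ← mulVec_sub]
  apply h
  rw [mulVec_sub, mulVec_mulVec, hQ.2.1, sub_self]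

theorem IsColProj.mul_eq {L : Type*} [Fintype L] {M : Matrix I J ℝ} {S : Matrix I I ℝ}
    (hS : IsColProj M S) {N : Matrix I L ℝ} (h : ∀ u, u ᵥ* M = 0 → u ᵥ* N = 0) : S * N = N := by
  classical
  rw [← transpose_inj, transpose_mul, hS.1.1]
  refine Matrix.ext_of_mulVec_single fun i => ?_
  rw [← mulVec_mulVec, eq_comm, ← sub_eq_zero, ← mulVec_sub, mulVec_transpose]
  apply h
  rw [sub_vecMul, ← vecMul_transpose, hS.1.1, vecMul_vecMul, hS.2.1, sub_self]

/-- Matrices tangent at `M` to the matrices of the rank of `M` have at most twice this rank. -/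
theorem rank_le_two_mul_of_tangent (M V : Matrix I J ℝ)
    (h : ∀ u w, u ᵥ* M = 0 → M *ᵥ w = 0 → u ⬝ᵥ (V *ᵥ w) = 0) : V.rank ≤ 2 * M.rank := by
  classical
  obtain ⟨Q, hQ⟩ := exists_isRowProj M
  obtain ⟨S, hS⟩ := exists_isColProj M
  -- The two complementary projections map onto the left and the right kernel of `M`, the only
  -- vectors on which `h` gives information.
  have h0 : (1 - S) * V * (1 - Q) = 0 := by
    ext i j
    have h1 := h (Pi.single i 1 ᵥ* (1 - S)) ((1 - Q) *ᵥ Pi.single j 1)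
      (by rw [vecMul_vecMul, Matrix.sub_mul, hS.2.1, Matrix.one_mul, sub_self, vecMul_zero])
      (by rw [mulVec_mulVec, Matrix.mul_sub, hQ.2.1, Matrix.mul_one, sub_self, zero_mulVec])
    rw [mulVec_mulVec, ← Matrix.dotProduct_mulVec, mulVec_mulVec] at h1
    simpa [Matrix.mul_assoc] using h1
  have h1 : V = S * V + ((1 - S) * V) * Q := by
    have : (1 - S) * V * (1 - Q) = V - (S * V + ((1 - S) * V) * Q) := by
      rw [Matrix.mul_sub, Matrix.mul_one, Matrix.sub_mul, Matrix.one_mul]; abel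
    rw [this, sub_eq_zero] at h0
    exact h0
  have hSr : S.rank ≤ M.rank := rank_le_of_vecMul_eq_zero hS.2.2
  have hQr : Q.rank ≤ M.rank := rank_le_of_mulVec_eq_zero hQ.2.2
  rw [h1]
  have := rank_add_le (S * V) (((1 - S) * V) * Q)
  have := rank_mul_le_left S V
  have := rank_mul_le_right ((1 - S) * V) Q
  omega

/-- Positive rank makes the set of positive singular values nonempty; it is finite, so its infimum
is attained. For the zero matrix the infimum would be that of the empty set. -/
theorem matrixSigmaMin_pos [DecidableEq J] {M : Matrix I J ℝ} (hM : 0 < M.rank) :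
    0 < matrixSigmaMin M := by
  set T := Matrix.toEuclideanLin M
  set s := {s : ℝ | 0 < s ∧ ∃ i : ℕ, s = T.singularValues i}
  have hfin : s.Finite := by
    refine (T.singularValues.support.finite_toSet.image T.singularValues).subset ?_
    rintro _ ⟨h, i, rfl⟩
    exact ⟨i, Finsupp.mem_support_iff.2 h.ne', rfl⟩
  have hne : s.Nonempty := by
    refine ⟨T.singularValues 0, ?_, 0, rfl⟩
    rw [LinearMap.singularValues_pos_iff_lt_finrank_range]
    rwa [Matrix.rank_eq_finrank_range_toLin M (EuclideanSpace.basisFun I ℝ).toBasis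
      (EuclideanSpace.basisFun J ℝ).toBasis, ← Matrix.toEuclideanLin_eq_toLin_orthonormal] at hM
  exact (hne.csInf_mem hfin).1

theorem matrixSigmaMin_le [DecidableEq J] (M : Matrix I J ℝ) {i : ℕ}
    (hi : 0 < (Matrix.toEuclideanLin M).singularValues i) :
    matrixSigmaMin M ≤ (Matrix.toEuclideanLin M).singularValues i :=
  csInf_le ⟨0, fun _ h => h.1.le⟩ ⟨hi, i, rfl⟩

theorem matrixSigmaMin_nonneg [DecidableEq J] (M : Matrix I J ℝ) : 0 ≤ matrixSigmaMin M :=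
  Real.sInf_nonneg fun _ h => h.1.le

/-- In an eigenbasis of `T* T`, a vector orthogonal to the kernel has no component at eigenvalue
zero, and every other eigenvalue is the square of a positive singular value. -/
theorem matrixSigmaMin_sq_mul_le [DecidableEq J] (M : Matrix I J ℝ) {w : EuclideanSpace ℝ J}
    (hw : w ∈ (Matrix.toEuclideanLin M).kerᗮ) :
    matrixSigmaMin M ^ 2 * ‖w‖ ^ 2 ≤ ‖Matrix.toEuclideanLin M w‖ ^ 2 := by
  set T := Matrix.toEuclideanLin M with hT
  have hs := T.isSymmetric_adjoint_comp_self
  let b := hs.eigenvectorBasis rfl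
  have key : ‖T w‖ ^ 2 = ∑ i, hs.eigenvalues rfl i * ‖inner ℝ (b i) w‖ ^ 2 := by
    rw [← real_inner_self_eq_norm_sq, ← LinearMap.adjoint_inner_right, ← b.sum_inner_mul_inner]
    refine Finset.sum_congr rfl fun i _ => ?_
    have h1 : inner ℝ (b i) ((LinearMap.adjoint T) (T w)) =
        hs.eigenvalues rfl i * inner ℝ (b i) w := by
      have := hs (b i) w
      rw [hs.apply_eigenvectorBasis] at this
      simp only [LinearMap.comp_apply] at this
      rw [← this, inner_smul_left]; simp [b]
    rw [h1, Real.norm_eq_abs, sq_abs, real_inner_comm]; ring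
  rw [key, ← b.sum_sq_norm_inner_right w, Finset.mul_sum]
  refine Finset.sum_le_sum fun i _ => ?_
  have hi : T.singularValues i ^ 2 = hs.eigenvalues rfl i := T.sq_singularValues_fin rfl i
  rcases (T.singularValues_nonneg i).eq_or_lt with h0 | h0
  · have hz : hs.eigenvalues rfl i = 0 := by rw [← hi, ← h0]; ring
    have h2 : T (b i) = 0 := by
      have h3 := hs.apply_eigenvectorBasis rfl i
      rw [hz] at h3
      have h4 : inner ℝ (T (b i)) (T (b i)) = 0 := by
        rw [← LinearMap.adjoint_inner_right]
        have : (LinearMap.adjoint T) (T (b i)) = 0 := by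
          rw [LinearMap.comp_apply] at h3
          simpa only [RCLike.ofReal_zero, zero_smul] using h3
        rw [this, inner_zero_right]
      exact inner_self_eq_zero.1 h4
    have h3 : inner ℝ (b i) w = 0 := hw (b i) h2
    simp [h3]
  · rw [← hi]
    refine mul_le_mul_of_nonneg_right ?_ (sq_nonneg _)
    exact pow_le_pow_left₀ (matrixSigmaMin_nonneg M) (matrixSigmaMin_le M h0) 2

/-- Every vector in the range of `M` has a preimage whose norm is controlled by the smallest
positive singular value. -/
theorem exists_mulVec_eq_of_matrixSigmaMin [DecidableEq J] (M : Matrix I J ℝ) (y : J → ℝ) :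
    ∃ w, M *ᵥ w = M *ᵥ y ∧
      matrixSigmaMin M ^ 2 * (w ⬝ᵥ w) ≤ (M *ᵥ y) ⬝ᵥ (M *ᵥ y) := by
  set T := Matrix.toEuclideanLin M with hT
  set w := T.kerᗮ.starProjection (WithLp.toLp 2 y)
  have hw : w ∈ T.kerᗮ := Submodule.starProjection_apply_mem _ _
  have h1 := Submodule.sub_starProjection_mem_orthogonal (K := T.kerᗮ) (WithLp.toLp 2 y)
  rw [Submodule.orthogonal_orthogonal, LinearMap.mem_ker, map_sub, sub_eq_zero] at h1
  have h2 : M *ᵥ w.ofLp = M *ᵥ y := by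
    have h2 := congrArg WithLp.ofLp h1
    simp only [T, Matrix.toLpLin_apply] at h2
    exact h2.symm
  refine ⟨w.ofLp, h2, ?_⟩
  have h3 := matrixSigmaMin_sq_mul_le M hw
  rw [EuclideanSpace.real_norm_sq_eq, EuclideanSpace.real_norm_sq_eq, Matrix.toLpLin_apply, h2]
    at h3
  simpa [dotProduct, sq] using h3

/-- Both complementary projections annihilate `X`, so each side contributes a factor `X - A`. For a
column `y` of `1 - Q`, replacing `y` by a short `w` with `A w = A y` gives `(1 - S) A y = -(1 - S)
(X - A) w`, while `‖w‖` is controlled by `‖A y‖ = ‖(X - A) y‖` divided by the smallest positive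
singular value of `A`. -/
theorem frobSq_one_sub_mul_mul_one_sub_le [DecidableEq I] [DecidableEq J] (A X : Matrix I J ℝ)
    {S : Matrix I I ℝ} {Q : Matrix J J ℝ} (hS : IsColProj X S) (hQ : IsRowProj X Q) :
    matrixSigmaMin A ^ 2 * frobSq ((1 - S) * A * (1 - Q)) ≤ frobSq (X - A) ^ 2 := by
  have h1 : (1 - S) * X = 0 := by
    rw [Matrix.sub_mul, hS.2.1, Matrix.one_mul, sub_self]
  have h2 : X * (1 - Q) = 0 := by
    rw [Matrix.mul_sub, hQ.2.1, Matrix.mul_one, sub_self]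
  calc matrixSigmaMin A ^ 2 * frobSq ((1 - S) * A * (1 - Q))
      ≤ frobSq (X - A) * frobSq ((X - A) * (1 - Q)) := by
        rw [frobSq_eq_sum_col, frobSq_eq_sum_col ((X - A) * (1 - Q)), Finset.mul_sum,
          Finset.mul_sum]
        refine Finset.sum_le_sum fun j _ => ?_
        set y : J → ℝ := fun i => (1 - Q) i j
        have hcol : ∀ N : Matrix I J ℝ,
            (fun i => (N * (1 - Q) : Matrix I J ℝ) i j) = N *ᵥ y := fun N => rfl
        rw [hcol, hcol]
        obtain ⟨w, hw, hσ⟩ := exists_mulVec_eq_of_matrixSigmaMin A y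
        have hXy : X *ᵥ y = 0 := by
          rw [← hcol, h2]; rfl
        have h3 : ((1 - S) * A) *ᵥ y = -((1 - S) *ᵥ ((X - A) *ᵥ w)) := by
          rw [← mulVec_mulVec, ← hw, mulVec_mulVec, mulVec_mulVec, Matrix.mul_sub, h1, zero_sub,
            neg_mulVec, neg_neg]
        have h4 : (X - A) *ᵥ y = -(A *ᵥ y) := by rw [sub_mulVec, hXy, zero_sub]
        rw [h3, h4, neg_dotProduct_neg, neg_dotProduct_neg]
        calc _ ≤ matrixSigmaMin A ^ 2 * (frobSq (X - A) * (w ⬝ᵥ w)) :=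
              mul_le_mul_of_nonneg_left ((hS.1.one_sub.dotProduct_le _).trans
                (dotProduct_mulVec_self_le _ _)) (sq_nonneg _)
          _ = frobSq (X - A) * (matrixSigmaMin A ^ 2 * (w ⬝ᵥ w)) := by ring
          _ ≤ _ := mul_le_mul_of_nonneg_left hσ (frobSq_nonneg _)
    _ ≤ frobSq (X - A) * frobSq (X - A) :=
        mul_le_mul_of_nonneg_left (hQ.1.one_sub.frobSq_mul_le' _) (frobSq_nonneg _)
    _ = frobSq (X - A) ^ 2 := by ring

end Matrices

/-! ### Rank along curves of matrices -/

section RankCurves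

open Matrix Filter Topology

variable {I J : Type*} [Fintype I] [Fintype J]

theorem exists_linearIndependent_mulVec (M : Matrix I J ℝ) :
    ∃ e : Fin M.rank → J → ℝ, LinearIndependent ℝ fun i => M *ᵥ e i := by
  let b := Module.finBasisOfFinrankEq ℝ M.mulVecLin.range (n := M.rank) rfl
  choose e he using fun i => (b i).2
  refine ⟨e, ?_⟩
  have : (fun i => M *ᵥ e i) = fun i => ((b i : M.mulVecLin.range) : I → ℝ) := funext he
  rw [this]
  exact b.linearIndependent.map' M.mulVecLin.range.subtype (Submodule.ker_subtype _)

theorem card_le_rank_of_linearIndependent {ι : Type*} [Fintype ι] {M : Matrix I J ℝ}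
    {f : ι → I → ℝ} (hf : LinearIndependent ℝ f) (h : ∀ i, f i ∈ M.mulVecLin.range) :
    Fintype.card ι ≤ M.rank := by
  rw [← finrank_span_eq_card hf]
  refine Submodule.finrank_mono (Submodule.span_le.2 ?_)
  rintro _ ⟨i, rfl⟩
  exact h i

/-- The rank is lower semicontinuous. -/
theorem eventually_rank_le {M : ℝ → Matrix I J ℝ} {t₀ : ℝ}
    (hM : ∀ w, ContinuousAt (fun t => M t *ᵥ w) t₀) : ∀ᶠ t in 𝓝 t₀, (M t₀).rank ≤ (M t).rank := by
  obtain ⟨e, he⟩ := exists_linearIndependent_mulVec (M t₀)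
  have h1 : Tendsto (fun t i => M t *ᵥ e i) (𝓝 t₀) (𝓝 fun i => M t₀ *ᵥ e i) :=
    tendsto_pi_nhds.2 fun i => hM (e i)
  filter_upwards [h1.eventually (isOpen_setOfPred_linearIndependent.eventually_mem he)] with t ht
  simpa using card_le_rank_of_linearIndependent (M := M t) ht fun i => ⟨e i, rfl⟩

/-- The velocity of a curve of matrices of constant rank is tangent to the matrices of this
rank. -/
theorem dotProduct_mulVec_eq_zero_of_hasDerivAt {M : ℝ → Matrix I J ℝ} {V : Matrix I J ℝ}
    (hV : ∀ w, HasDerivAt (fun t => M t *ᵥ w) (V *ᵥ w) 0)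
    (hrank : ∀ᶠ t in 𝓝 0, (M t).rank ≤ (M 0).rank) {u : I → ℝ} {w : J → ℝ}
    (hu : u ᵥ* M 0 = 0) (hw : M 0 *ᵥ w = 0) : u ⬝ᵥ (V *ᵥ w) = 0 := by
  by_contra hne
  obtain ⟨e, he⟩ := exists_linearIndependent_mulVec (M 0)
  -- If `u ⬝ᵥ V w ≠ 0`, then `V w` lies outside the range of `M 0`. The vectors `t⁻¹ M(t) w → V w`
  -- and `M(t) eᵢ → M(0) eᵢ` would then be independent for small `t ≠ 0`: one more than the rank
  -- allows.
  let g : ℝ → Option (Fin (M 0).rank) → I → ℝ := fun t o =>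
    o.elim (t⁻¹ • M t *ᵥ w) fun i => M t *ᵥ e i
  let g₀ : Option (Fin (M 0).rank) → I → ℝ := fun o => o.elim (V *ᵥ w) fun i => M 0 *ᵥ e i
  have hg : Tendsto g (𝓝[≠] 0) (𝓝 g₀) := by
    refine tendsto_pi_nhds.2 fun o => ?_
    cases o with
    | none =>
      have := (hV w).tendsto_slope_zero
      simpa [g, g₀, hw] using this
    | some i => exact ((hV (e i)).continuousAt.tendsto).mono_left nhdsWithin_le_nhds
  have hg₀ : LinearIndependent ℝ g₀ := by
    rw [linearIndependent_option]
    refine ⟨he, fun hmem => hne ?_⟩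
    have hle : Submodule.span ℝ (Set.range (g₀ ∘ (↑) : Fin (M 0).rank → I → ℝ)) ≤
        (dotProductBilin ℝ ℝ u).ker := by
      refine Submodule.span_le.2 ?_
      rintro _ ⟨i, rfl⟩
      change u ⬝ᵥ (M 0 *ᵥ e i) = 0
      rw [Matrix.dotProduct_mulVec, hu, zero_dotProduct]
    exact hle hmem
  obtain ⟨t, ht, hr⟩ := ((hg.eventually
    (isOpen_setOfPred_linearIndependent.eventually_mem hg₀)).and
      (hrank.filter_mono nhdsWithin_le_nhds)).exists
  have := card_le_rank_of_linearIndependent (M := M t) ht fun o => by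
    cases o with
    | none => exact ⟨t⁻¹ • w, by simp [g]⟩
    | some i => exact ⟨e i, rfl⟩
  simp at this
  omega

end RankCurves

/-! ### Unfoldings and the nesting of their column and row spaces -/

section Unfoldings

open Matrix

variable {m : ℕ} {n : Fin (m + 1) → ℕ}

/-- The tensor with a given unfolding. -/
def fold (k : Fin m)
    (M : Matrix ((i : {i : Fin (m + 1) // i ≤ k.castSucc}) → Fin (n i))
      ((i : {i : Fin (m + 1) // ¬ i ≤ k.castSucc}) → Fin (n i)) ℝ) : Tensor n :=
  WithLp.toLp 2 fun i => M (fun l => i l) fun l => i l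

theorem unfolding_fold (k : Fin m)
    (M : Matrix ((i : {i : Fin (m + 1) // i ≤ k.castSucc}) → Fin (n i))
      ((i : {i : Fin (m + 1) // ¬ i ≤ k.castSucc}) → Fin (n i)) ℝ) :
    unfolding k (fold k M) = M := by
  ext a b
  have := (Equiv.piEquivPiSubtypeProd (fun i => i ≤ k.castSucc) fun i => Fin (n i)).apply_symm_apply
    (a, b)
  change (fun p : _ × _ => M p.1 p.2)
    ((Equiv.piEquivPiSubtypeProd (fun i => i ≤ k.castSucc) fun i => Fin (n i))
      ((Equiv.piEquivPiSubtypeProd (fun i => i ≤ k.castSucc) fun i => Fin (n i)).symm (a, b))) = _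
  rw [this]

theorem fold_unfolding (k : Fin m) (X : Tensor n) : fold k (unfolding k X) = X := by
  ext i
  exact congrArg X.ofLp
    ((Equiv.piEquivPiSubtypeProd (fun i => i ≤ k.castSucc) fun i => Fin (n i)).symm_apply_apply i)

theorem unfolding_add (k : Fin m) (X Y : Tensor n) :
    unfolding k (X + Y) = unfolding k X + unfolding k Y := rfl

theorem unfolding_sub (k : Fin m) (X Y : Tensor n) :
    unfolding k (X - Y) = unfolding k X - unfolding k Y := rfl

theorem unfolding_smul (k : Fin m) (c : ℝ) (X : Tensor n) :
    unfolding k (c • X) = c • unfolding k X := rfl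

theorem norm_sq_eq_frobSq (k : Fin m) (X : Tensor n) : ‖X‖ ^ 2 = frobSq (unfolding k X) := by
  rw [EuclideanSpace.real_norm_sq_eq, frobSq, ← Fintype.sum_prod_type',
    ← (Equiv.piEquivPiSubtypeProd (fun i => i ≤ k.castSucc) fun i => Fin (n i)).symm.sum_comp]
  rfl

/-- Multiplication of the `k`-th unfolding by a matrix from the left. -/
def unfoldingMulLeft (k : Fin m)
    (S : Matrix ((i : {i : Fin (m + 1) // i ≤ k.castSucc}) → Fin (n i))
      ((i : {i : Fin (m + 1) // i ≤ k.castSucc}) → Fin (n i)) ℝ) : Tensor n →ₗ[ℝ] Tensor n where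
  toFun Z := fold k (S * unfolding k Z)
  map_add' Y Z := by rw [unfolding_add, Matrix.mul_add]; rfl
  map_smul' c Z := by rw [unfolding_smul, Matrix.mul_smul]; rfl

/-- Multiplication of the `k`-th unfolding by a matrix from the right. -/
def unfoldingMulRight (k : Fin m)
    (Q : Matrix ((i : {i : Fin (m + 1) // ¬ i ≤ k.castSucc}) → Fin (n i))
      ((i : {i : Fin (m + 1) // ¬ i ≤ k.castSucc}) → Fin (n i)) ℝ) : Tensor n →ₗ[ℝ] Tensor n where
  toFun Z := fold k (unfolding k Z * Q)
  map_add' Y Z := by rw [unfolding_add, Matrix.add_mul]; rfl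
  map_smul' c Z := by rw [unfolding_smul, Matrix.smul_mul]; rfl

theorem unfolding_unfoldingMulLeft (k : Fin m)
    (S : Matrix ((i : {i : Fin (m + 1) // i ≤ k.castSucc}) → Fin (n i))
      ((i : {i : Fin (m + 1) // i ≤ k.castSucc}) → Fin (n i)) ℝ) (Z : Tensor n) :
    unfolding k (unfoldingMulLeft k S Z) = S * unfolding k Z := unfolding_fold _ _

theorem unfolding_unfoldingMulRight (k : Fin m)
    (Q : Matrix ((i : {i : Fin (m + 1) // ¬ i ≤ k.castSucc}) → Fin (n i))
      ((i : {i : Fin (m + 1) // ¬ i ≤ k.castSucc}) → Fin (n i)) ℝ) (Z : Tensor n) :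
    unfolding k (unfoldingMulRight k Q Z) = unfolding k Z * Q := unfolding_fold _ _

/-- Multiplications of unfoldings from the left and from the right act on disjoint sets of modes
and commute. -/
theorem unfoldingMulRight_unfoldingMulLeft {j k : Fin m} (hjk : j ≤ k)
    (S : Matrix ((i : {i : Fin (m + 1) // i ≤ j.castSucc}) → Fin (n i))
      ((i : {i : Fin (m + 1) // i ≤ j.castSucc}) → Fin (n i)) ℝ)
    (Q : Matrix ((i : {i : Fin (m + 1) // ¬ i ≤ k.castSucc}) → Fin (n i))
      ((i : {i : Fin (m + 1) // ¬ i ≤ k.castSucc}) → Fin (n i)) ℝ) (Z : Tensor n) :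
    unfoldingMulRight k Q (unfoldingMulLeft j S Z) =
      unfoldingMulLeft j S (unfoldingMulRight k Q Z) := by
  have hjk' : j.castSucc ≤ k.castSucc := hjk
  ext i
  simp only [unfoldingMulRight, unfoldingMulLeft, fold, unfolding, LinearMap.coe_mk, AddHom.coe_mk,
    Matrix.mul_apply, Matrix.of_apply, Finset.sum_mul, Finset.mul_sum]
  rw [Finset.sum_comm]
  refine Finset.sum_congr rfl fun a _ => Finset.sum_congr rfl fun e _ => ?_
  rw [mul_assoc]
  congr 1
  · congr 1
    funext l
    simp [l.2.trans hjk']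
  · congr 1
    · refine congrArg Z.ofLp (funext fun l => ?_)
      by_cases h1 : l ≤ j.castSucc
      · simp [h1, h1.trans hjk']
      · by_cases h2 : l ≤ k.castSucc <;> simp [h1, h2]
    · congr 1
      funext l
      have hl : ¬ l.1 ≤ j.castSucc := fun h => l.2 (h.trans hjk')
      simp [hl]

/-- The column spaces of the unfoldings of `Z` are contained in those of `X`, for the cut `k`. -/
def ColLE (k : Fin m) (X Z : Tensor n) : Prop :=
  ∀ u, u ᵥ* unfolding k X = 0 → u ᵥ* unfolding k Z = 0

/-- The row spaces of the unfoldings of `Z` are contained in those of `X`, for the cut `k`. -/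
def RowLE (k : Fin m) (X Z : Tensor n) : Prop :=
  ∀ w, unfolding k X *ᵥ w = 0 → unfolding k Z *ᵥ w = 0

/-- Freezing the modes between the two cuts turns a left kernel vector at `j` into one at `k`: `u`
is tensored with a unit vector in these modes. -/
theorem ColLE.of_le {j k : Fin m} (hjk : j ≤ k) {X Z : Tensor n} (h : ColLE k X Z) :
    ColLE j X Z := by
  have hjk' : j.castSucc ≤ k.castSucc := hjk
  intro u hu
  ext b
  let c : ((i : {i : Fin (m + 1) // i ≤ j.castSucc}) → Fin (n i)) →
      (i : {i : Fin (m + 1) // i ≤ k.castSucc}) → Fin (n i) := fun a l =>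
    if hl : l.1 ≤ j.castSucc then a ⟨l.1, hl⟩ else b ⟨l.1, hl⟩
  have key : ∀ (Y : Tensor n) (e : (i : {i : Fin (m + 1) // ¬ i ≤ k.castSucc}) → Fin (n i)),
      ((∑ a, u a • Pi.single (c a) (1 : ℝ)) ᵥ* unfolding k Y) e =
        (u ᵥ* unfolding j Y) fun l =>
          if hl : l.1 ≤ k.castSucc then b l else e ⟨l.1, hl⟩ := by
    intro Y e
    simp only [sum_vecMul, smul_vecMul, single_one_vecMul, Finset.sum_apply, Pi.smul_apply,
      smul_eq_mul]
    refine Finset.sum_congr rfl fun a _ => ?_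
    simp only [unfolding, Matrix.row, Matrix.of_apply]
    refine congrArg (_ * ·) (congrArg Y.ofLp (funext fun l => ?_))
    by_cases h1 : l ≤ j.castSucc
    · simp [h1, h1.trans hjk', c]
    · by_cases h2 : l ≤ k.castSucc <;> simp [h1, h2, c]
  have h1 := h (∑ a, u a • Pi.single (c a) (1 : ℝ)) (by
    ext e
    rw [key, hu]; rfl)
  have h2 := congrFun h1 fun l => b ⟨l.1, fun hl => l.2 (hl.trans hjk')⟩
  rw [key] at h2
  exact (congrArg (u ᵥ* unfolding j Z) (funext fun l => by split_ifs <;> rfl)).trans h2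

/-- The mirror image of `ColLE.of_le`: row spaces are inherited by later cuts, column spaces by
earlier ones. -/
theorem RowLE.of_le {j k : Fin m} (hjk : j ≤ k) {X Z : Tensor n} (h : RowLE j X Z) :
    RowLE k X Z := by
  have hjk' : j.castSucc ≤ k.castSucc := hjk
  intro w hw
  ext a
  let c : ((i : {i : Fin (m + 1) // ¬ i ≤ k.castSucc}) → Fin (n i)) →
      (i : {i : Fin (m + 1) // ¬ i ≤ j.castSucc}) → Fin (n i) := fun e l =>
    if hl : l.1 ≤ k.castSucc then a ⟨l.1, hl⟩ else e ⟨l.1, hl⟩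
  have key : ∀ (Y : Tensor n) (a' : (i : {i : Fin (m + 1) // i ≤ j.castSucc}) → Fin (n i)),
      (unfolding j Y *ᵥ (∑ e, w e • Pi.single (c e) (1 : ℝ))) a' =
        (unfolding k Y *ᵥ w) fun l =>
          if hl : l.1 ≤ j.castSucc then a' ⟨l.1, hl⟩ else a l := by
    intro Y a'
    simp only [mulVec_sum, mulVec_smul, mulVec_single_one, Finset.sum_apply, Pi.smul_apply,
      smul_eq_mul]
    rw [mulVec, dotProduct]
    refine Finset.sum_congr rfl fun e _ => ?_
    rw [mul_comm]
    simp only [unfolding, Matrix.col, Matrix.of_apply, Matrix.transpose_apply]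
    refine congrArg (· * _) (congrArg Y.ofLp (funext fun l => ?_))
    by_cases h1 : l ≤ j.castSucc
    · simp [h1, h1.trans hjk', c]
    · by_cases h2 : l ≤ k.castSucc <;> simp [h1, h2, c]
  have h1 := h (∑ e, w e • Pi.single (c e) (1 : ℝ)) (by
    ext a'
    rw [key, hw]; rfl)
  have h2 := congrFun h1 fun l => a ⟨l.1, l.2.trans hjk'⟩
  rw [key] at h2
  exact (congrArg (unfolding k Z *ᵥ w) (funext fun l => by split_ifs <;> rfl)).trans h2

end Unfoldings

/-! ### Tangent vectors: rank bound and a sufficient criterion -/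

section Tangent

open Matrix Filter Topology

variable {m : ℕ} {n : Fin (m + 1) → ℕ} {r : Fin m → ℕ} {X : Tensor n}

theorem hasDerivAt_unfolding_mulVec (k : Fin m) {γ : ℝ → Tensor n} {v : Tensor n} {t : ℝ}
    (h : HasDerivAt γ v t)
    (w : ((i : {i : Fin (m + 1) // ¬ i ≤ k.castSucc}) → Fin (n i)) → ℝ) :
    HasDerivAt (fun t => unfolding k (γ t) *ᵥ w) (unfolding k v *ᵥ w) t := by
  let L : Tensor n →ₗ[ℝ] (((i : {i : Fin (m + 1) // i ≤ k.castSucc}) → Fin (n i)) → ℝ) :=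
    { toFun := fun Z => unfolding k Z *ᵥ w
      map_add' := fun Y Z => by rw [unfolding_add, add_mulVec]
      map_smul' := fun c Z => by rw [unfolding_smul, smul_mulVec]; rfl }
  exact (LinearMap.toContinuousLinearMap L).hasFDerivAt.comp_hasDerivAt t h

theorem dotProduct_mulVec_eq_zero_of_mem_tangentSpace {v : Tensor n}
    (hv : v ∈ tangentSpace r X) (k : Fin m)
    {u : ((i : {i : Fin (m + 1) // i ≤ k.castSucc}) → Fin (n i)) → ℝ}
    {w : ((i : {i : Fin (m + 1) // ¬ i ≤ k.castSucc}) → Fin (n i)) → ℝ}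
    (hu : u ᵥ* unfolding k X = 0) (hw : unfolding k X *ᵥ w = 0) :
    u ⬝ᵥ (unfolding k v *ᵥ w) = 0 := by
  induction hv using Submodule.span_induction with
  | mem v hv =>
    obtain ⟨ε, γ, hε, -, hS, h0, hd⟩ := hv
    subst h0
    refine dotProduct_mulVec_eq_zero_of_hasDerivAt (M := fun t => unfolding k (γ t))
      (hasDerivAt_unfolding_mulVec k hd) ?_ hu hw
    filter_upwards [Ioo_mem_nhds (neg_lt_zero.2 hε) hε] with t ht
    rw [hS t ht k, hS 0 ⟨neg_lt_zero.2 hε, hε⟩ k]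
  | zero =>
    have : unfolding k (0 : Tensor n) = 0 := rfl
    rw [this, zero_mulVec, dotProduct_zero]
  | add x y _ _ hx hy => rw [unfolding_add, add_mulVec, dotProduct_add, hx, hy, add_zero]
  | smul c x _ hx => rw [unfolding_smul, smul_mulVec, dotProduct_smul, hx, smul_zero]

theorem rank_unfolding_le_of_mem_tangentSpace (hX : X ∈ fixedRank n r) {v : Tensor n}
    (hv : v ∈ tangentSpace r X) (k : Fin m) : (unfolding k v).rank ≤ 2 * r k := by
  rw [← hX k]
  exact rank_le_two_mul_of_tangent _ _ fun _ _ hu hw =>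
    dotProduct_mulVec_eq_zero_of_mem_tangentSpace hv k hu hw

/-- A direction in which the column or the row space of each unfolding does not grow is tangent. -/
theorem mem_tangentSpace (hX : X ∈ fixedRank n r) {W : Tensor n}
    (hW : ∀ k, ColLE k X W ∨ RowLE k X W) : W ∈ tangentSpace r X := by
  -- The curve is the straight line through `X`. Its ranks never exceed `r` by the containment of
  -- column or row spaces, and near `t = 0` they cannot drop.
  have hd : ∀ t : ℝ, HasDerivAt (fun t : ℝ => X + t • W) W t := fun t => by
    simpa using ((hasDerivAt_id t).smul_const W).const_add X
  have hle : ∀ k t, (unfolding k (X + t • W)).rank ≤ r k := fun k t => by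
    rw [← hX k]
    rcases hW k with h | h
    · refine rank_le_of_vecMul_eq_zero fun u hu => ?_
      rw [unfolding_add, unfolding_smul, vecMul_add, vecMul_smul, hu, h u hu]; simp
    · refine rank_le_of_mulVec_eq_zero fun w hw => ?_
      rw [unfolding_add, unfolding_smul, add_mulVec, smul_mulVec, hw, h w hw]; simp
  have hge : ∀ᶠ t : ℝ in 𝓝 0, ∀ k, r k ≤ (unfolding k (X + t • W)).rank := by
    refine eventually_all.2 fun k => ?_
    have := eventually_rank_le (M := fun t : ℝ => unfolding k (X + t • W)) (t₀ := 0) fun w =>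
      (hasDerivAt_unfolding_mulVec k (hd 0) w).continuousAt
    simpa [hX k] using this
  obtain ⟨ε, hε, h⟩ := Metric.eventually_nhds_iff.1 hge
  refine Submodule.subset_span ⟨ε, fun t => X + t • W, hε, ?_, fun t ht k => ?_, by simp, hd 0⟩
  · exact (contDiff_const.add (contDiff_id.smul contDiff_const)).contDiffOn
  · refine le_antisymm (hle k t) (h ?_ k)
    rw [Real.dist_eq, sub_zero, abs_lt]
    exact ht

end Tangent

/-! ### Distance of `A` from the tangent space at `X` -/

section Curvature

open Matrix

variable {m : ℕ} {n : Fin (m + 1) → ℕ}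

/-- The projections given by left multiplications of the unfoldings, preceded by the identity. -/
def leftProj (S : (k : Fin m) → Matrix ((i : {i : Fin (m + 1) // i ≤ k.castSucc}) → Fin (n i))
      ((i : {i : Fin (m + 1) // i ≤ k.castSucc}) → Fin (n i)) ℝ) :
    Fin (m + 1) → Tensor n →ₗ[ℝ] Tensor n :=
  Fin.cases LinearMap.id fun k => unfoldingMulLeft k (S k)

variable {S : (k : Fin m) → Matrix ((i : {i : Fin (m + 1) // i ≤ k.castSucc}) → Fin (n i))
      ((i : {i : Fin (m + 1) // i ≤ k.castSucc}) → Fin (n i)) ℝ}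
  {Q : (k : Fin m) → Matrix ((i : {i : Fin (m + 1) // ¬ i ≤ k.castSucc}) → Fin (n i))
      ((i : {i : Fin (m + 1) // ¬ i ≤ k.castSucc}) → Fin (n i)) ℝ}
  {r : Fin m → ℕ} {X : Tensor n}

theorem leftProj_zero (Z : Tensor n) : leftProj S 0 Z = Z := rfl

theorem leftProj_succ (k : Fin m) (Z : Tensor n) :
    leftProj S k.succ Z = unfoldingMulLeft k (S k) Z := rfl

theorem norm_leftProj_le (hS : ∀ k, IsOrthProj (S k)) (j : Fin (m + 1)) (Z : Tensor n) :
    ‖leftProj S j Z‖ ≤ ‖Z‖ := by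
  cases j using Fin.cases with
  | zero => rfl
  | succ k =>
    refine le_of_sq_le_sq ?_ (norm_nonneg _)
    rw [norm_sq_eq_frobSq k, norm_sq_eq_frobSq k, leftProj_succ, unfolding_unfoldingMulLeft]
    exact (hS k).frobSq_mul_le _

theorem unfoldingMulRight_leftProj {j : Fin (m + 1)} {k : Fin m} (hjk : j ≤ k.castSucc)
    (Z : Tensor n) :
    unfoldingMulRight k (Q k) (leftProj S j Z) = leftProj S j (unfoldingMulRight k (Q k) Z) := by
  cases j using Fin.cases with
  | zero => rfl
  | succ i =>
    exact unfoldingMulRight_unfoldingMulLeft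
      (Nat.le_of_succ_le hjk) _ _ _

theorem colLE_leftProj (hS : ∀ k, IsColProj (unfolding k X) (S k)) {j : Fin (m + 1)} {k : Fin m}
    (hkj : k.castSucc < j) (Z : Tensor n) : ColLE k X (leftProj S j Z) := by
  cases j using Fin.cases with
  | zero => simp at hkj
  | succ i =>
    refine ColLE.of_le (k := i) (Nat.le_of_lt_succ hkj)
      fun u hu => ?_
    rw [leftProj_succ, unfolding_unfoldingMulLeft, ← vecMul_vecMul, (hS i).2.2 u hu, zero_vecMul]

/-- Index `k.succ` is the projection at cut `k`, and `k.castSucc` the one at the preceding cut (or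
the identity). The later projection already lands in the column space of the earlier one, by
nesting. -/
theorem leftProj_castSucc_succ (hS : ∀ k, IsColProj (unfolding k X) (S k)) (k : Fin m)
    (Z : Tensor n) : leftProj S k.castSucc (leftProj S k.succ Z) = leftProj S k.succ Z := by
  generalize hj : k.castSucc = j
  cases j using Fin.cases with
  | zero => rfl
  | succ i =>
    have hik : i.castSucc < k.succ := by
      have := congrArg Fin.val hj
      rw [Fin.lt_def]; simp at this ⊢; omega
    rw [leftProj_succ i]
    change fold i (S i * _) = _
    rw [(hS i).mul_eq (colLE_leftProj hS hik Z), fold_unfolding]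

/-- The curvature estimate `‖(I - P_X) A‖ ≤ ‖X - A‖² / σ_min(A)`. -/
theorem norm_sub_starProjection_tangentSpace_le (hX : X ∈ fixedRank n r) {A : Tensor n}
    (hA : ∀ k, 0 < (unfolding k A).rank) :
    ‖A - (tangentSpace r X).starProjection A‖ ≤ ‖X - A‖ ^ 2 / sigmaMin A := by
  choose S hS using fun k => exists_isColProj (unfolding k X)
  choose Q hQ using fun k => exists_isRowProj (unfolding k X)
  let G : Fin m → Tensor n := fun k => A - leftProj S k.succ A
  have hG : ∀ k : Fin m, leftProj S k.castSucc A - leftProj S k.succ A =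
      leftProj S k.castSucc (G k) := fun k => by
    rw [map_sub, leftProj_castSucc_succ hS]
  -- The tangent approximation of the `k`-th telescoping difference: the left factor keeps the
  -- column spaces at all cuts before `k`, the right factor keeps the row spaces at `k` and all
  -- later cuts.
  let D : Fin m → Tensor n := fun k => leftProj S k.castSucc (unfoldingMulRight k (Q k) (G k))
  have hD : ∀ k, D k ∈ tangentSpace r X := fun k => by
    refine mem_tangentSpace hX fun j => ?_
    rcases lt_or_ge j k with hjk | hjk
    · exact Or.inl (colLE_leftProj hS hjk _)
    · refine Or.inr (RowLE.of_le hjk fun w hw => ?_)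
      simp only [D]
      rw [← unfoldingMulRight_leftProj le_rfl, unfolding_unfoldingMulRight, ← mulVec_mulVec,
        (hQ k).2.2 w hw, mulVec_zero]
  have hlast : leftProj S (Fin.last m) A ∈ tangentSpace r X :=
    mem_tangentSpace hX fun j => Or.inl (colLE_leftProj hS (Fin.castSucc_lt_last j) _)
  have hB : ∑ k, D k + leftProj S (Fin.last m) A ∈ tangentSpace r X :=
    add_mem (sum_mem fun k _ => hD k) hlast
  have hsplit : A - (∑ k, D k + leftProj S (Fin.last m) A) =
      ∑ k : Fin m, leftProj S k.castSucc (G k - unfoldingMulRight k (Q k) (G k)) := by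
    have h1 := (Fin.sum_univ_castSucc fun j => leftProj S j A).symm.trans
      (Fin.sum_univ_succ fun j => leftProj S j A)
    rw [leftProj_zero] at h1
    have h2 : ∑ k : Fin m, leftProj S k.castSucc (G k) =
        ∑ k : Fin m, leftProj S k.castSucc A - ∑ k : Fin m, leftProj S k.succ A := by
      rw [← Finset.sum_sub_distrib]
      exact Finset.sum_congr rfl fun k _ => (hG k).symm
    rw [show ∑ k : Fin m, leftProj S k.castSucc (G k - unfoldingMulRight k (Q k) (G k)) =
        ∑ k : Fin m, leftProj S k.castSucc (G k) - ∑ k, D k from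
        (Finset.sum_congr rfl fun k _ => map_sub _ _ _).trans (Finset.sum_sub_distrib _ _), h2,
      eq_sub_of_add_eq h1]
    abel
  have hterm : ∀ k : Fin m, ‖leftProj S k.castSucc (G k - unfoldingMulRight k (Q k) (G k))‖ ≤
      ‖X - A‖ ^ 2 * (1 / matrixSigmaMin (unfolding k A)) := fun k => by
    refine (norm_leftProj_le (fun k => (hS k).1) _ _).trans ?_
    rw [mul_one_div, le_div_iff₀ (matrixSigmaMin_pos (hA k))]
    refine le_of_sq_le_sq ?_ (sq_nonneg _)
    have h1 := frobSq_one_sub_mul_mul_one_sub_le (unfolding k A) (unfolding k X) (hS k) (hQ k)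
    rw [← unfolding_sub, ← norm_sq_eq_frobSq] at h1
    have h2 : unfolding k (G k - unfoldingMulRight k (Q k) (G k)) =
        (1 - S k) * unfolding k A * (1 - Q k) := by
      rw [unfolding_sub, unfolding_unfoldingMulRight, unfolding_sub, leftProj_succ,
        unfolding_unfoldingMulLeft, Matrix.mul_sub, Matrix.mul_one, Matrix.sub_mul 1, Matrix.one_mul]
    rw [mul_pow, norm_sq_eq_frobSq k, h2]
    linarith
  -- The orthogonal projection is the best approximation, so any explicit tangent vector bounds the
  -- distance.
  have hmin : ‖A - (tangentSpace r X).starProjection A‖ ≤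
      ‖A - (∑ k, D k + leftProj S (Fin.last m) A)‖ := by
    rw [Submodule.starProjection_minimal]
    exact ciInf_le ⟨0, by rintro _ ⟨y, rfl⟩; exact norm_nonneg _⟩
      (⟨_, hB⟩ : tangentSpace r X)
  refine hmin.trans ?_
  rw [hsplit, sigmaMin, div_inv_eq_mul, Finset.mul_sum]
  exact norm_sum_le_of_le _ fun k _ => hterm k

theorem sigmaMin_pos (hm : 0 < m) {A : Tensor n} (hA : ∀ k, 0 < (unfolding k A).rank) :
    0 < sigmaMin A :=
  inv_pos.2 (Finset.sum_pos (fun k _ => one_div_pos.2 (matrixSigmaMin_pos (hA k)))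
    ⟨⟨0, hm⟩, Finset.mem_univ _⟩)

end Curvature

/-! ### Truncated SVD: Eckart–Young and Pythagoras -/

section TruncatedSVD

open Matrix

variable {I J : Type*} [Fintype I] [Fintype J]

theorem IsOrthProj.trace_eq_rank [DecidableEq I] {S : Matrix I I ℝ} (hS : IsOrthProj S) :
    S.trace = S.rank := by
  have h : LinearMap.IsProj S.mulVecLin.range S.mulVecLin := by
    refine ⟨fun x => ⟨x, rfl⟩, ?_⟩
    rintro _ ⟨x, rfl⟩
    simp only [mulVecLin_apply, mulVec_mulVec, hS.2]
  rw [← Matrix.trace_toLin'_eq]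
  exact h.trace

theorem frobSq_mul_diagonal_mul {q : ℕ} {u : Matrix I (Fin q) ℝ} {v : Matrix J (Fin q) ℝ}
    (hu : uᵀ * u = 1) (hv : vᵀ * v = 1) (τ : Fin q → ℝ) :
    frobSq (u * diagonal τ * vᵀ) = ∑ i, τ i ^ 2 := by
  rw [frobSq_eq_trace]
  have : (u * diagonal τ * vᵀ)ᵀ * (u * diagonal τ * vᵀ) =
      v * (diagonal τ * (uᵀ * u) * diagonal τ * vᵀ) := by
    simp only [transpose_mul, transpose_transpose, diagonal_transpose, Matrix.mul_assoc]
  rw [this, trace_mul_comm, hu, Matrix.mul_assoc, hv, Matrix.mul_one, Matrix.mul_one,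
    diagonal_mul_diagonal, trace_diagonal]
  simp [sq]

theorem frobSq_transpose_mul_le {q : ℕ} {u : Matrix I (Fin q) ℝ} (hu : uᵀ * u = 1)
    (N : Matrix I J ℝ) : frobSq (uᵀ * N) ≤ frobSq N := by
  have hp : IsOrthProj (u * uᵀ) := by
    refine ⟨by rw [transpose_mul, transpose_transpose], ?_⟩
    rw [Matrix.mul_assoc, ← Matrix.mul_assoc uᵀ, hu, Matrix.one_mul]
  have h : frobSq (uᵀ * N) = frobSq (u * uᵀ * N) := by
    rw [frobSq_eq_trace, frobSq_eq_trace]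
    congr 1
    have : (u * uᵀ * N)ᵀ * (u * uᵀ * N) = Nᵀ * (u * (uᵀ * u) * (uᵀ * N)) := by
      simp only [transpose_mul, transpose_transpose, Matrix.mul_assoc]
    rw [this, hu, Matrix.mul_one, transpose_mul, transpose_transpose]
    simp only [Matrix.mul_assoc]
  rw [h]
  exact hp.frobSq_mul_le N

theorem IsOrthProj.frobSq_eq_add [DecidableEq I] {S : Matrix I I ℝ} (hS : IsOrthProj S)
    (M : Matrix I J ℝ) : frobSq M = frobSq (S * M) + frobSq ((1 - S) * M) := by
  rw [frobSq_eq_trace, frobSq_eq_trace, frobSq_eq_trace, ← trace_add]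
  congr 1
  rw [transpose_mul, transpose_mul, hS.1, hS.one_sub.1, Matrix.mul_assoc, Matrix.mul_assoc,
    ← Matrix.mul_assoc S, ← Matrix.mul_assoc (1 - S), hS.2, hS.one_sub.2, ← Matrix.mul_add,
    ← Matrix.add_mul, add_sub_cancel, Matrix.one_mul]

/-- Weights in `[0, 1]` of sum at most `p` pick at most the `p` largest values. -/
theorem sum_natAdd_le_sum_mul_one_sub {p t : ℕ} {σ w : Fin (p + t) → ℝ} (hσ : ∀ i, 0 ≤ σ i)
    (hanti : Antitone σ) (hw₀ : ∀ i, 0 ≤ w i) (hw₁ : ∀ i, w i ≤ 1) (hw : ∑ i, w i ≤ p) :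
    ∑ j : Fin t, σ (Fin.natAdd p j) ≤ ∑ i, σ i * (1 - w i) := by
  -- A threshold between the first `p` values and the tail; with an empty tail, `0` serves.
  obtain ⟨τ, hτ, h1, h2⟩ : ∃ τ : ℝ, 0 ≤ τ ∧ (∀ i : Fin p, τ ≤ σ (Fin.castAdd t i)) ∧
      ∀ j : Fin t, σ (Fin.natAdd p j) ≤ τ := by
    rcases Nat.eq_zero_or_pos t with rfl | ht
    · exact ⟨0, le_rfl, fun i => hσ _, fun j => j.elim0⟩
    · refine ⟨σ (Fin.natAdd p ⟨0, ht⟩), hσ _, fun i => hanti ?_, fun j => hanti ?_⟩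
      · rw [Fin.le_def]; simp only [Fin.val_castAdd, Fin.val_natAdd]; omega
      · rw [Fin.le_def]; simp
  rw [Fin.sum_univ_add] at hw ⊢
  have h3 : ∑ i : Fin p, τ * (1 - w (Fin.castAdd t i)) ≤
      ∑ i : Fin p, σ (Fin.castAdd t i) * (1 - w (Fin.castAdd t i)) :=
    Finset.sum_le_sum fun i _ => mul_le_mul_of_nonneg_right (h1 i) (sub_nonneg.2 (hw₁ _))
  have h4 : ∑ j : Fin t, (σ (Fin.natAdd p j) - τ * w (Fin.natAdd p j)) ≤
      ∑ j : Fin t, σ (Fin.natAdd p j) * (1 - w (Fin.natAdd p j)) :=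
    Finset.sum_le_sum fun j _ => by
      have := mul_le_mul_of_nonneg_right (h2 j) (hw₀ (Fin.natAdd p j))
      linarith
  rw [← Finset.mul_sum, Finset.sum_sub_distrib] at h3
  rw [Finset.sum_sub_distrib, ← Finset.mul_sum] at h4
  simp only [Finset.sum_const, Finset.card_univ, Fintype.card_fin, nsmul_eq_mul, mul_one] at h3
  nlinarith [mul_nonneg hτ (sub_nonneg.2 hw)]

variable {p : ℕ} {M : Matrix I J ℝ} {U : Matrix I (Fin p) ℝ} {C : Matrix (Fin p) J ℝ}

theorem IsTruncatedSVD.transpose_mul_self (h : IsTruncatedSVD M U C) : Uᵀ * U = 1 := by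
  obtain ⟨q, hpq, u, σ, v, hu, hv, hσ, hanti, rfl, rfl, rfl⟩ := h
  ext a b
  have := congrFun (congrFun hu (Fin.castLE hpq a)) (Fin.castLE hpq b)
  refine this.trans ?_
  simp only [Matrix.one_apply, (Fin.castLE_injective hpq).eq_iff]

theorem IsTruncatedSVD.eq_transpose_mul (h : IsTruncatedSVD M U C) : C = Uᵀ * M := by
  obtain ⟨q, hpq, u, σ, v, hu, hv, hσ, hanti, rfl, rfl, rfl⟩ := h
  have h1 : (u.submatrix id (Fin.castLE hpq))ᵀ * (u * diagonal σ * vᵀ) =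
      (uᵀ * (u * diagonal σ * vᵀ)).submatrix (Fin.castLE hpq) id := rfl
  rw [h1, Matrix.mul_assoc, ← Matrix.mul_assoc uᵀ, hu, Matrix.one_mul]

/-- The Eckart–Young theorem for the Frobenius norm. -/
theorem IsTruncatedSVD.frobSq_sub_le (h : IsTruncatedSVD M U C) {B : Matrix I J ℝ}
    (hB : B.rank ≤ p) : frobSq (M - U * C) ≤ frobSq (M - B) := by
  classical
  obtain ⟨q, hpq, u, σ, v, hu, hv, hσ, hanti, rfl, rfl, rfl⟩ := h
  obtain ⟨t, rfl⟩ := Nat.exists_eq_add_of_le hpq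
  obtain ⟨S, hS⟩ := exists_isColProj B
  set M := u * diagonal σ * vᵀ with hM
  let τ : Fin (p + t) → ℝ := Fin.addCases (fun _ => 0) fun j => σ (Fin.natAdd p j)
  have hleft : frobSq (M - u.submatrix id (Fin.castLE hpq) *
      (diagonal σ * vᵀ).submatrix (Fin.castLE hpq) id) =
        ∑ j : Fin t, σ (Fin.natAdd p j) ^ 2 := by
    have h1 : M - u.submatrix id (Fin.castLE hpq) *
        (diagonal σ * vᵀ).submatrix (Fin.castLE hpq) id =
          u * diagonal τ * vᵀ := by
      rw [hM, Matrix.mul_assoc, Matrix.mul_assoc]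
      ext i j
      rw [Matrix.sub_apply]
      simp only [Matrix.mul_apply (M := u), Matrix.mul_apply (M := submatrix _ _ _),
        diagonal_mul, Fin.sum_univ_add, τ, Matrix.submatrix_apply, Fin.addCases_left,
        Fin.addCases_right, zero_mul, mul_zero, Finset.sum_const_zero, zero_add, id]
      exact add_sub_cancel_left _ _
    rw [h1, frobSq_mul_diagonal_mul hu hv, Fin.sum_univ_add]
    simp [τ]
  -- The share of each left singular vector captured by the column space of `B`. The shares add up
  -- to at most the trace of `S`, that is its rank, so they cannot beat selecting the `p` largest
  -- singular values.
  let w : Fin (p + t) → ℝ := fun i => (fun a => (S * u) a i) ⬝ᵥ (fun a => (S * u) a i)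
  have hw₀ : ∀ i, 0 ≤ w i := fun i => Finset.sum_nonneg fun _ _ => mul_self_nonneg _
  have hw₁ : ∀ i, w i ≤ 1 := fun i => by
    refine (hS.1.dotProduct_le fun a => u a i).trans_eq ?_
    have := congrFun (congrFun hu i) i
    rwa [one_apply_eq] at this
  have hw : ∑ i, w i ≤ p := by
    rw [← frobSq_eq_sum_col, ← frobSq_transpose, transpose_mul, hS.1.1]
    refine (frobSq_transpose_mul_le hu S).trans ?_
    rw [frobSq_eq_trace, hS.1.1, hS.1.2, hS.1.trace_eq_rank]
    exact_mod_cast (rank_le_of_vecMul_eq_zero hS.2.2).trans hB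
  have hSM : frobSq (S * M) = ∑ i, σ i ^ 2 * w i := by
    rw [frobSq_eq_trace']
    have h1 : S * M * (S * M)ᵀ = (S * u * diagonal σ) * (vᵀ * v) * (S * u * diagonal σ)ᵀ := by
      rw [hM]
      simp only [transpose_mul, transpose_transpose, Matrix.mul_assoc]
    rw [h1, hv, Matrix.mul_one, ← frobSq_eq_trace', frobSq_eq_sum_col]
    refine Finset.sum_congr rfl fun i _ => ?_
    simp only [mul_diagonal, dotProduct, w, Finset.mul_sum]
    exact Finset.sum_congr rfl fun a _ => by ring
  have h1 := hS.1.frobSq_eq_add M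
  have h2 : frobSq ((1 - S) * M) ≤ frobSq (M - B) := by
    have : (1 - S) * M = (1 - S) * (M - B) := by
      rw [Matrix.mul_sub, Matrix.sub_mul 1 S B, hS.2.1, Matrix.one_mul, sub_self, sub_zero]
    rw [this]
    exact hS.1.one_sub.frobSq_mul_le _
  have h3 := sum_natAdd_le_sum_mul_one_sub (fun i => sq_nonneg (σ i))
    (fun i j hij => pow_le_pow_left₀ (hσ j) (hanti hij) 2) hw₀ hw₁ hw
  simp only [mul_sub, mul_one, Finset.sum_sub_distrib] at h3
  rw [hM, frobSq_mul_diagonal_mul hu hv, ← hM] at h1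
  rw [hleft]
  linarith

/-- Pythagoras: the residual `M - U C` is orthogonal to the range of `U`. This separates the
truncation error of one TT-SVD step from the errors of later steps. -/
theorem IsTruncatedSVD.frobSq_sub_mul (h : IsTruncatedSVD M U C) (Z : Matrix (Fin p) J ℝ) :
    frobSq (M - U * Z) = frobSq (M - U * C) + frobSq (C - Z) := by
  have hU := h.transpose_mul_self
  have h0 : Uᵀ * (M - U * C) = 0 := by
    rw [Matrix.mul_sub, ← Matrix.mul_assoc, hU, Matrix.one_mul, h.eq_transpose_mul, sub_self]
  have h1 : M - U * Z = (M - U * C) + U * (C - Z) := by rw [Matrix.mul_sub]; abel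
  have h2 : (M - U * C)ᵀ * U = 0 := by
    rw [← transpose_inj, transpose_mul, transpose_transpose, h0, transpose_zero]
  rw [h1, frobSq_eq_trace, frobSq_eq_trace, frobSq_eq_trace (C - Z), ← trace_add]
  congr 1
  generalize M - U * C = N at h0 h2
  rw [transpose_add, Matrix.add_mul, Matrix.mul_add, Matrix.mul_add, transpose_mul,
    ← Matrix.mul_assoc Nᵀ, h2, Matrix.mul_assoc _ _ N, h0, Matrix.mul_assoc,
    ← Matrix.mul_assoc Uᵀ, hU]
  simp

theorem exists_eq_mul_of_rank (M : Matrix I J ℝ) :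
    ∃ (F : Matrix I (Fin M.rank) ℝ) (G : Matrix (Fin M.rank) J ℝ), M = F * G := by
  classical
  let b := Module.finBasisOfFinrankEq ℝ M.mulVecLin.range (n := M.rank) rfl
  refine ⟨Matrix.of fun i c => (b c : I → ℝ) i,
    Matrix.of fun c j => b.repr ⟨M *ᵥ Pi.single j 1, _, rfl⟩ c, ?_⟩
  ext i j
  have h := congrArg (fun z : M.mulVecLin.range => (z : I → ℝ) i)
    (b.sum_repr ⟨M *ᵥ Pi.single j 1, _, rfl⟩)
  simp only [Submodule.coe_sum, Submodule.coe_smul, Finset.sum_apply, Pi.smul_apply,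
    smul_eq_mul, mulVec_single_one] at h
  rw [Matrix.mul_apply]
  refine h.symm.trans (Finset.sum_congr rfl fun c _ => ?_)
  rw [mul_comm]
  simp

end TruncatedSVD

/-! ### Quasi-optimality of the TT-SVD -/

section TTSVD

open Matrix

/-- The cut `k` separates the array `B` with a bond of dimension `ρ`; the leading index belongs to
the modes left of the cut. -/
def HasCut {m : ℕ} {n : Fin (m + 1) → ℕ} {p : ℕ} (k : Fin m) (ρ : ℕ)
    (B : Fin p → ((i : Fin (m + 1)) → Fin (n i)) → ℝ) : Prop :=
  ∃ (F : Fin p → ((i : Fin (m + 1)) → Fin (n i)) → Fin ρ → ℝ)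
    (G : Fin ρ → ((i : Fin (m + 1)) → Fin (n i)) → ℝ),
    (∀ a i i', (∀ l ≤ k.castSucc, i l = i' l) → F a i = F a i') ∧
    (∀ b i i', (∀ l, ¬ l ≤ k.castSucc → i l = i' l) → G b i = G b i') ∧
    ∀ a i, B a i = ∑ b, F a i b * G b i

theorem hasCut_of_mem_fixedRank {m : ℕ} {n : Fin (m + 1) → ℕ} {r : Fin m → ℕ} {A : Tensor n}
    (hA : A ∈ fixedRank n r) (k : Fin m) : HasCut k (r k) fun (_ : Fin 1) i => A i := by
  rw [← hA k]
  obtain ⟨F, G, h⟩ := exists_eq_mul_of_rank (unfolding k A)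
  refine ⟨fun _ i => F fun l => i l, fun b i => G b fun l => i l, fun _ i i' hi => ?_,
    fun b i i' hi => ?_, fun _ i => ?_⟩
  · exact congrArg F (funext fun l => hi l l.2)
  · exact congrArg (G b) (funext fun l => hi l l.2)
  · have h1 := congrArg (fun N => (fold k N).ofLp i) h
    rw [fold_unfolding] at h1
    exact h1

/-- The matrix whose truncated SVD is the first step of the TT-SVD. -/
def flatten {m : ℕ} {n : Fin (m + 2) → ℕ} {p : ℕ}
    (C : Fin p → ((i : Fin (m + 2)) → Fin (n i)) → ℝ) :
    Matrix (Fin p × Fin (n 0)) ((i : Fin (m + 1)) → Fin (n i.succ)) ℝ :=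
  Matrix.of fun a j => C a.1 (Fin.cons (α := fun i => Fin (n i)) a.2 j)

theorem sum_sub_sq_eq_frobSq_flatten {m : ℕ} {n : Fin (m + 2) → ℕ} {p : ℕ}
    (C B : Fin p → ((i : Fin (m + 2)) → Fin (n i)) → ℝ) :
    ∑ a, ∑ i, (C a i - B a i) ^ 2 = frobSq (flatten C - flatten B) := by
  rw [frobSq, Fintype.sum_prod_type]
  refine Finset.sum_congr rfl fun a _ => ?_
  rw [← (Fin.consEquiv fun i => Fin (n i)).sum_comp, Fintype.sum_prod_type]
  rfl

/-- Each factor ignores the modes beyond its side of the cut, so these can be frozen at index `0`;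
positivity of the sizes supplies that index. -/
theorem HasCut.rank_flatten_le {m : ℕ} {n : Fin (m + 2) → ℕ} (hn : ∀ i, 0 < n i) {p ρ : ℕ}
    {B : Fin p → ((i : Fin (m + 2)) → Fin (n i)) → ℝ} (h : HasCut 0 ρ B) :
    (flatten B).rank ≤ ρ := by
  obtain ⟨F, G, hF, hG, hB⟩ := h
  let F₀ : Matrix (Fin p × Fin (n 0)) (Fin ρ) ℝ := fun a c =>
    F a.1 (Fin.cons (α := fun i => Fin (n i)) a.2 fun i => ⟨0, hn i.succ⟩) c
  let G₀ : Matrix (Fin ρ) ((i : Fin (m + 1)) → Fin (n i.succ)) ℝ := fun c j =>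
    G c (Fin.cons (α := fun i => Fin (n i)) ⟨0, hn 0⟩ j)
  have : flatten B = F₀ * G₀ := by
    ext a j
    rw [flatten, Matrix.of_apply, hB, Matrix.mul_apply]
    refine Finset.sum_congr rfl fun c _ => ?_
    refine congrArg₂ (· * ·) ?_ ?_
    · refine congrFun (hF _ _ _ fun l hl => ?_) c
      obtain rfl : l = 0 := by simpa using hl
      rfl
    · refine hG _ _ _ fun l hl => ?_
      cases l using Fin.cases with
      | zero => simp at hl
      | succ l => rfl
  rw [this]
  exact (rank_mul_le_right _ _).trans
    ((rank_le_card_height _).trans_eq (Fintype.card_fin ρ))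

/-- Contracting the first mode acts only on the left factor of every later cut. Thus the compressed
competitor remains admissible in the induction. -/
theorem HasCut.contract {m : ℕ} {n : Fin (m + 2) → ℕ} (hn : 0 < n 0) {p q ρ : ℕ} {k : Fin m}
    {B : Fin p → ((i : Fin (m + 2)) → Fin (n i)) → ℝ} (h : HasCut k.succ ρ B)
    (U : Matrix (Fin p × Fin (n 0)) (Fin q) ℝ) :
    HasCut (n := fun i => n i.succ) k ρ (Uᵀ * flatten B : Matrix _ _ ℝ) := by
  obtain ⟨F, G, hF, hG, hB⟩ := h
  refine ⟨fun b j c => ∑ a, U a b * F a.1 (Fin.cons (α := fun i => Fin (n i)) a.2 j) c,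
    fun c j => G c (Fin.cons (α := fun i => Fin (n i)) ⟨0, hn⟩ j), fun b j j' hj => ?_,
    fun c j j' hj => ?_, fun b j => ?_⟩
  · funext c
    refine Finset.sum_congr rfl fun a _ => ?_
    congr 1
    refine congrFun (hF _ _ _ fun l hl => ?_) c
    cases l using Fin.cases with
    | zero => rfl
    | succ l => exact hj l (Nat.le_of_succ_le_succ hl)
  · refine hG _ _ _ fun l hl => ?_
    cases l using Fin.cases with
    | zero => rfl
    | succ l => exact hj l fun h => hl (Nat.succ_le_succ h)
  · rw [Matrix.mul_apply]
    simp only [flatten, Matrix.of_apply, hB, Finset.mul_sum, Finset.sum_mul, transpose_apply]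
    rw [Finset.sum_comm]
    refine Finset.sum_congr rfl fun c _ => Finset.sum_congr rfl fun a _ => ?_
    rw [mul_assoc]
    congr 2
    refine hG _ _ _ fun l hl => ?_
    cases l using Fin.cases with
    | zero => exact absurd (Fin.zero_le _) hl
    | succ l => rfl

theorem sum_sub_sq_le_of_isTTSVDFrom : ∀ {m : ℕ} {n : Fin (m + 1) → ℕ} (_ : ∀ i, 0 < n i)
    (r : Fin m → ℕ) {p : ℕ} (C Z B : Fin p → ((i : Fin (m + 1)) → Fin (n i)) → ℝ),
    IsTTSVDFrom r C Z → (∀ k, HasCut k (r k) B) →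
      ∑ a, ∑ i, (C a i - Z a i) ^ 2 ≤ m * ∑ a, ∑ i, (C a i - B a i) ^ 2
  | 0, n, _, r, p, C, Z, B, h, _ => by
    have h : Z = C := h
    simp [h]
  | m + 1, n, hn, r, p, C, Z, B, h, hB => by
    obtain ⟨U, C', Z', hsvd, hrec, hZ⟩ := h
    change IsTruncatedSVD (flatten C) U (Matrix.of C') at hsvd
    -- The remainder is compared with `Uᵀ B`: compression by `Uᵀ` does not increase the distance.
    -- Each step thus adds at most one copy of `‖C - B‖²`, hence the factor `m`.
    have ih := sum_sub_sq_le_of_isTTSVDFrom (fun i => hn i.succ) (fun k => r k.succ) C' Z'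
      (Uᵀ * flatten B : Matrix _ _ ℝ) hrec fun k => (hB k.succ).contract (hn 0) U
    have hflat : flatten Z = U * Matrix.of Z' := by
      ext a j
      rw [flatten, Matrix.of_apply, hZ, Matrix.mul_apply]
      rfl
    have h1 := hsvd.frobSq_sub_mul (Matrix.of Z')
    have h2 := hsvd.frobSq_sub_le ((hB 0).rank_flatten_le hn)
    have h3 : frobSq (Matrix.of C' - Uᵀ * flatten B) ≤ frobSq (flatten C - flatten B) := by
      rw [hsvd.eq_transpose_mul, ← Matrix.mul_sub]
      exact frobSq_transpose_mul_le hsvd.transpose_mul_self _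
    rw [sum_sub_sq_eq_frobSq_flatten, sum_sub_sq_eq_frobSq_flatten, hflat, h1]
    have h4 : frobSq (Matrix.of C' - Matrix.of Z') ≤
        m * frobSq (Matrix.of C' - Uᵀ * flatten B) := ih
    have h5 := mul_le_mul_of_nonneg_left h3 (Nat.cast_nonneg (α := ℝ) m)
    push_cast
    linarith

/-- Quasi-optimality of the TT-SVD. -/
theorem IsTTSVD.norm_sub_le {m : ℕ} {n : Fin (m + 1) → ℕ} {r : Fin m → ℕ} (hn : ∀ i, 0 < n i)
    {Y Z A : Tensor n} (h : IsTTSVD r Y Z) (hA : A ∈ fixedRank n r) :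
    ‖Y - Z‖ ≤ √(m : ℝ) * ‖Y - A‖ := by
  have h1 := sum_sub_sq_le_of_isTTSVDFrom hn r _ _ _ h (hasCut_of_mem_fixedRank hA)
  refine le_of_sq_le_sq ?_ (by positivity)
  rw [mul_pow, Real.sq_sqrt (Nat.cast_nonneg _), EuclideanSpace.real_norm_sq_eq,
    EuclideanSpace.real_norm_sq_eq]
  simpa using h1

theorem pos_of_mem_fixedRank {m : ℕ} {n : Fin (m + 1) → ℕ} {r : Fin m → ℕ} (hm : 0 < m)
    (hr : ∀ k, 0 < r k) {A : Tensor n} (hA : A ∈ fixedRank n r) (i : Fin (m + 1)) : 0 < n i := by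
  by_contra h
  have hA0 : A = 0 := by
    ext j
    exact absurd (j i).pos h
  have h1 := hA ⟨0, hm⟩
  have h2 : unfolding (⟨0, hm⟩ : Fin m) (0 : Tensor n) = 0 := rfl
  rw [hA0, h2, rank_zero] at h1
  exact (hr _).ne h1

end TTSVD

/-! ### A line-search gradient step relative to a subspace -/

section GradientStep

variable {E F : Type*} [NormedAddCommGroup E] [InnerProductSpace ℝ E] [CompleteSpace E]
  [NormedAddCommGroup F] [InnerProductSpace ℝ F] [CompleteSpace F]

/-- The bilinear form of `I - α R* R` is bounded by its quadratic form. -/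
theorem inner_sub_mul_inner_le (R : E →L[ℝ] F) (T : Submodule ℝ E) {α c : ℝ}
    (h : ∀ x ∈ T, |‖x‖ ^ 2 - α * ‖R x‖ ^ 2| ≤ c * ‖x‖ ^ 2) {x y : E} (hx : x ∈ T) (hy : y ∈ T) :
    inner ℝ x y - α * inner ℝ (R x) (R y) ≤ c * ‖x‖ * ‖y‖ := by
  rcases (mul_nonneg (norm_nonneg x) (norm_nonneg y)).eq_or_lt with h0 | h0
  · rcases mul_eq_zero.1 h0.symm with h1 | h1 <;> simp [norm_eq_zero.1 h1]
  -- Polarization, with both vectors rescaled to the common norm `‖x‖ ‖y‖` so that the parallelogram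
  -- law gives the sharp constant.
  have h1 := (abs_le.1 (h (‖y‖ • x + ‖x‖ • y)
    (T.add_mem (T.smul_mem _ hx) (T.smul_mem _ hy)))).2
  have h2 := (abs_le.1 (h (‖y‖ • x - ‖x‖ • y)
    (T.sub_mem (T.smul_mem _ hx) (T.smul_mem _ hy)))).1
  simp only [map_add, map_sub, map_smul, norm_add_sq_real, norm_sub_sq_real, norm_smul,
    Real.norm_eq_abs, abs_norm, inner_smul_left, inner_smul_right, RCLike.conj_to_real] at h1 h2
  refine le_of_mul_le_mul_left ?_ h0
  nlinarith

/-- One gradient step in the subspace `T` with exact line search. -/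
theorem norm_sub_lineSearch_sq_le (R : E →L[ℝ] F) (T : Submodule ℝ E)
    [T.HasOrthogonalProjection] {δ C : ℝ} (hδ₀ : 0 < δ) (hδ₁ : δ < 1) (hC : 0 ≤ C)
    (hT : ∀ y ∈ T, (1 - δ) * ‖y‖ ^ 2 ≤ ‖R y‖ ^ 2 ∧ ‖R y‖ ^ 2 ≤ (1 + δ) * ‖y‖ ^ 2) (e : E)
    (hcross : ∀ y ∈ T, |inner ℝ (R (e - T.starProjection e)) (R y)| ≤
      C * ‖e - T.starProjection e‖ * ‖y‖) :
    ‖e - (‖T.starProjection (ContinuousLinearMap.adjoint R (R e))‖ ^ 2 /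
        ‖R (T.starProjection (ContinuousLinearMap.adjoint R (R e)))‖ ^ 2) •
          T.starProjection (ContinuousLinearMap.adjoint R (R e))‖ ^ 2 ≤
      ‖e - T.starProjection e‖ ^ 2 +
        (2 * δ / (1 - δ) * ‖e‖ + C / (1 - δ) * ‖e - T.starProjection e‖) ^ 2 := by
  set Y := T.starProjection (ContinuousLinearMap.adjoint R (R e)) with hY
  have hYT : Y ∈ T := Submodule.starProjection_apply_mem _ _
  have hpT : T.starProjection e ∈ T := Submodule.starProjection_apply_mem _ _
  have h1δ : 0 < 1 - δ := sub_pos.2 hδ₁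
  obtain ⟨α, hα, hα₀, hα₁, hα₂⟩ : ∃ α : ℝ, (‖Y‖ ^ 2 / ‖R Y‖ ^ 2) • Y = α • Y ∧ 0 ≤ α ∧
      1 ≤ α * (1 + δ) ∧ α * (1 - δ) ≤ 1 := by
    rcases eq_or_ne Y 0 with h0 | h0
    -- For `Y = 0` the step size is irrelevant. The default quotient `0` would violate the lower
    -- bound, so `1` replaces it.
    · exact ⟨1, by simp [h0], zero_le_one, by linarith, by linarith⟩
    · have hy : 0 < ‖Y‖ ^ 2 := by positivity
      have hRy : 0 < ‖R Y‖ ^ 2 := lt_of_lt_of_le (mul_pos h1δ hy) (hT Y hYT).1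
      refine ⟨_, rfl, by positivity, ?_, ?_⟩
      · rw [div_mul_eq_mul_div, one_le_div hRy]
        linarith [(hT Y hYT).2]
      · rw [div_mul_eq_mul_div, div_le_one hRy]
        linarith [(hT Y hYT).1]
  rw [hα]
  set z := e - T.starProjection e with hz
  set w := T.starProjection e - α • Y with hw
  have hwT : w ∈ T := T.sub_mem hpT (T.smul_mem _ hYT)
  have hzT : ∀ y ∈ T, inner ℝ z y = 0 := fun y hy =>
    Submodule.starProjection_inner_eq_zero e y hy
  have hsplit : e - α • Y = z + w := by rw [hz, hw]; abel
  have hα₃ : α ≤ 1 / (1 - δ) := by rwa [le_div_iff₀ h1δ]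
  set c := 2 * δ / (1 - δ) with hc
  have hc₀ : 0 ≤ c := by positivity
  have hcm : c * (1 - δ) = 2 * δ := by rw [hc]; field_simp
  have hquad : ∀ x ∈ T, |‖x‖ ^ 2 - α * ‖R x‖ ^ 2| ≤ c * ‖x‖ ^ 2 := fun x hx => by
    obtain ⟨ha, hb⟩ := hT x hx
    have hx2 := sq_nonneg ‖x‖
    have ha' := mul_le_mul_of_nonneg_left ha hα₀
    have hb' := mul_le_mul_of_nonneg_left hb hα₀
    have hlow : 1 - α * (1 - δ) ≤ c := by
      have : c * (1 - δ) ≥ (1 - α * (1 - δ)) * (1 - δ) := by nlinarith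
      exact le_of_mul_le_mul_right this h1δ
    have hup : α * (1 + δ) - 1 ≤ c := by
      have : (α * (1 + δ) - 1) * (1 - δ) ≤ c * (1 - δ) := by nlinarith
      exact le_of_mul_le_mul_right this h1δ
    have hlow' := mul_le_mul_of_nonneg_right hlow hx2
    have hup' := mul_le_mul_of_nonneg_right hup hx2
    rw [abs_le]
    constructor <;> linarith
  have hb := inner_sub_mul_inner_le R T hquad hpT hwT
  have hYw : inner ℝ Y w = inner ℝ (R e) (R w) := by
    rw [hY, Submodule.inner_starProjection_left_eq_right,
      Submodule.starProjection_eq_self_iff.2 hwT, ContinuousLinearMap.adjoint_inner_left]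
  -- Testing `w` against itself leaves the form of `I - α R* R` on `T`, plus a cross term from the
  -- normal part `z`.
  have hww : ‖w‖ ^ 2 = inner ℝ (T.starProjection e) w -
      α * inner ℝ (R (T.starProjection e)) (R w) - α * inner ℝ (R z) (R w) := by
    have h1 : inner ℝ (R e) (R w) =
        inner ℝ (R (T.starProjection e)) (R w) + inner ℝ (R z) (R w) := by
      rw [← inner_add_left, ← map_add, hz, add_sub_cancel]
    have h2 : ‖w‖ ^ 2 = inner ℝ (T.starProjection e) w - α * inner ℝ Y w := by
      rw [← real_inner_self_eq_norm_sq]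
      conv_lhs => rw [hw]
      rw [← hw, inner_sub_left, real_inner_smul_left]
    rw [h2, hYw, h1]; ring
  have hpe : ‖T.starProjection e‖ ≤ ‖e‖ := Submodule.norm_starProjection_apply_le _ _
  have hwle : ‖w‖ ≤ c * ‖e‖ + C / (1 - δ) * ‖z‖ := by
    rcases (norm_nonneg w).eq_or_lt with h0 | h0
    · rw [← h0]; positivity
    · refine le_of_mul_le_mul_right ?_ h0
      have h1 := mul_le_mul_of_nonneg_left (abs_le.1 (hcross w hwT)).1 hα₀
      have h2 : α * (C * ‖z‖ * ‖w‖) ≤ 1 / (1 - δ) * (C * ‖z‖ * ‖w‖) :=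
        mul_le_mul_of_nonneg_right hα₃ (by positivity)
      have h3 : c * ‖T.starProjection e‖ * ‖w‖ ≤ c * ‖e‖ * ‖w‖ := by gcongr
      have h4 : 1 / (1 - δ) * (C * ‖z‖ * ‖w‖) = C / (1 - δ) * ‖z‖ * ‖w‖ := by ring
      nlinarith
  rw [hsplit, norm_add_sq_real, hzT w hwT, mul_zero, add_zero]
  gcongr

end GradientStep

/-! ### One step of Riemannian gradient descent -/

section RGD

variable {m : ℕ} {n : Fin (m + 1) → ℕ} {r : Fin m → ℕ} {s : ℕ}
  {R : Tensor n →L[ℝ] EuclideanSpace ℝ (Fin s)} {A X : Tensor n} {δ C : ℝ}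

theorem starProjection_tangentSpace_self (hX : X ∈ fixedRank n r) :
    (tangentSpace r X).starProjection X = X :=
  Submodule.starProjection_eq_self_iff.2 (mem_tangentSpace hX fun _ => Or.inl fun _ h => h)

theorem sub_sub_starProjection_tangentSpace (hX : X ∈ fixedRank n r) (A : Tensor n) :
    X - A - (tangentSpace r X).starProjection (X - A) =
      (tangentSpace r X).starProjection A - A := by
  rw [map_sub, starProjection_tangentSpace_self hX]
  abel

theorem rank_unfolding_sub_le (k : Fin m) (Y Z : Tensor n) :
    (unfolding k (Y - Z)).rank ≤ (unfolding k Y).rank + (unfolding k Z).rank := by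
  rw [unfolding_sub, sub_eq_add_neg]
  refine (rank_add_le _ _).trans (Nat.add_le_add_left ?_ _)
  refine rank_le_of_mulVec_eq_zero fun w hw => ?_
  rw [Matrix.neg_mulVec, hw, neg_zero]

/-- `R* R` is bounded by `C` between the tangent space at `X` and the normal part of `X - A`. -/
theorem abs_inner_le (hA : A ∈ fixedRank n r) (hX : X ∈ fixedRank n r)
    (hC : ‖(ContinuousLinearMap.adjoint R).comp R‖ ≤ C ∨
      ∃ δ₃ : ℝ, HasRIP R (fun k => 3 * r k) δ₃ ∧ C = 1 + δ₃) {y : Tensor n}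
    (hy : y ∈ tangentSpace r X) :
    |inner ℝ (R (X - A - (tangentSpace r X).starProjection (X - A))) (R y)| ≤
      C * ‖X - A - (tangentSpace r X).starProjection (X - A)‖ * ‖y‖ := by
  rcases hC with hC | ⟨δ₃, ⟨h0, h1, hR⟩, rfl⟩
  · generalize X - A - (tangentSpace r X).starProjection (X - A) = z
    rw [← ContinuousLinearMap.adjoint_inner_left]
    refine (abs_real_inner_le_norm _ _).trans (mul_le_mul_of_nonneg_right ?_ (norm_nonneg _))
    exact (((ContinuousLinearMap.adjoint R).comp R).le_opNorm z).trans
      (mul_le_mul_of_nonneg_right hC (norm_nonneg _))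
  · rw [sub_sub_starProjection_tangentSpace hX]
    -- Rank `2r` from the tangent vector plus `r` from `A`: this is where order `3r` is needed.
    have hz := (hR ((tangentSpace r X).starProjection A - A) fun k => by
      have h2 := rank_unfolding_sub_le k ((tangentSpace r X).starProjection A) A
      have h3 := rank_unfolding_le_of_mem_tangentSpace hX
        (Submodule.starProjection_apply_mem (tangentSpace r X) A) k
      have h4 := hA k
      dsimp only
      omega).2
    have hy := (hR y fun k => by
      have h3 := rank_unfolding_le_of_mem_tangentSpace hX hy k
      dsimp only
      omega).2
    refine (abs_real_inner_le_norm _ _).trans ?_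
    refine le_of_sq_le_sq ?_ (by positivity)
    calc _ = ‖R ((tangentSpace r X).starProjection A - A)‖ ^ 2 * ‖R y‖ ^ 2 := by ring
      _ ≤ ((1 + δ₃) * ‖(tangentSpace r X).starProjection A - A‖ ^ 2) *
          ((1 + δ₃) * ‖y‖ ^ 2) := mul_le_mul hz hy (sq_nonneg _) (by positivity)
      _ = _ := by ring

theorem nonneg_of_bound
    (hC : ‖(ContinuousLinearMap.adjoint R).comp R‖ ≤ C ∨
      ∃ δ₃ : ℝ, HasRIP R (fun k => 3 * r k) δ₃ ∧ C = 1 + δ₃) : 0 ≤ C := by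
  rcases hC with hC | ⟨δ₃, ⟨h0, -, -⟩, rfl⟩
  · exact (norm_nonneg _).trans hC
  · linarith

/-- Strictness comes from passing from `√(a² + b²)` to `a + b`: both bounds are positive when `X ≠
A`, the second because `δ > 0`. -/
theorem norm_gradientStep_sub_lt (hm : 0 < m) (hr : ∀ k, 0 < r k) (hA : A ∈ fixedRank n r)
    (hδ : HasRIP R (fun k => 2 * r k) δ)
    (hC : ‖(ContinuousLinearMap.adjoint R).comp R‖ ≤ C ∨
      ∃ δ₃ : ℝ, HasRIP R (fun k => 3 * r k) δ₃ ∧ C = 1 + δ₃)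
    (hX : X ∈ fixedRank n r) (hXA : X ≠ A) :
    ‖X - stepSize R r A X • riemannianGradient R r A X - A‖ <
      (2 * δ / (1 - δ) + (1 + C / (1 - δ)) * (‖X - A‖ / sigmaMin A)) * ‖X - A‖ := by
  obtain ⟨hδ₀, hδ₁, hR⟩ := hδ
  have h1δ : 0 < 1 - δ := sub_pos.2 hδ₁
  have hC₀ := nonneg_of_bound hC
  have hAr : ∀ k, 0 < (unfolding k A).rank := fun k => by rw [hA k]; exact hr k
  have hσ := sigmaMin_pos hm hAr
  have hD : 0 < ‖X - A‖ := norm_pos_iff.2 (sub_ne_zero.2 hXA)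
  have h1 := norm_sub_lineSearch_sq_le R (tangentSpace r X) hδ₀ hδ₁ hC₀
    (fun y hy => hR y (rank_unfolding_le_of_mem_tangentSpace hX hy)) (X - A)
    fun y hy => abs_inner_le hA hX hC hy
  have h2 : ‖X - A - (tangentSpace r X).starProjection (X - A)‖ ≤ ‖X - A‖ ^ 2 / sigmaMin A := by
    rw [sub_sub_starProjection_tangentSpace hX, norm_sub_rev]
    exact norm_sub_starProjection_tangentSpace_le hX hAr
  have h3 : X - stepSize R r A X • riemannianGradient R r A X - A =
      X - A - stepSize R r A X • riemannianGradient R r A X := by abel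
  rw [h3]
  simp only [stepSize, riemannianGradient, ← map_sub] at h1 ⊢
  refine lt_of_pow_lt_pow_left₀ 2 (by positivity) (h1.trans_lt ?_)
  set ζ := ‖X - A‖ ^ 2 / sigmaMin A with hζ
  have hζ₀ : 0 < ζ := by positivity
  have hb : 0 < 2 * δ / (1 - δ) * ‖X - A‖ + C / (1 - δ) * ζ := by positivity
  have h4 : (2 * δ / (1 - δ) + (1 + C / (1 - δ)) * (‖X - A‖ / sigmaMin A)) * ‖X - A‖ =
      ζ + (2 * δ / (1 - δ) * ‖X - A‖ + C / (1 - δ) * ζ) := by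
    rw [hζ]; ring
  rw [h4, add_sq]
  have h5 : ‖X - A - (tangentSpace r X).starProjection (X - A)‖ ^ 2 +
      (2 * δ / (1 - δ) * ‖X - A‖ + C / (1 - δ) *
        ‖X - A - (tangentSpace r X).starProjection (X - A)‖) ^ 2 ≤
      ζ ^ 2 + (2 * δ / (1 - δ) * ‖X - A‖ + C / (1 - δ) * ζ) ^ 2 := by gcongr
  have h6 := mul_pos hζ₀ hb
  linarith

theorem IsRGDStep.norm_sub_le {X' : Tensor n} (hn : ∀ i, 0 < n i) (hA : A ∈ fixedRank n r)
    (h : IsRGDStep R r A X X') :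
    ‖X' - A‖ ≤ (1 + √(m : ℝ)) * ‖X - stepSize R r A X • riemannianGradient R r A X - A‖ := by
  have h1 := IsTTSVD.norm_sub_le hn h hA
  have h2 := norm_sub_le_norm_sub_add_norm_sub X'
    (X - stepSize R r A X • riemannianGradient R r A X) A
  rw [norm_sub_rev X' (X - _)] at h2
  linarith

theorem IsRGDStep.norm_sub_lt {X' : Tensor n} (hm : 0 < m) (hr : ∀ k, 0 < r k)
    (hA : A ∈ fixedRank n r) (hδ : HasRIP R (fun k => 2 * r k) δ)
    (hC : ‖(ContinuousLinearMap.adjoint R).comp R‖ ≤ C ∨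
      ∃ δ₃ : ℝ, HasRIP R (fun k => 3 * r k) δ₃ ∧ C = 1 + δ₃)
    (hX : X ∈ fixedRank n r) (hXA : X ≠ A) (h : IsRGDStep R r A X X') :
    ‖X' - A‖ < contractionFactor A X δ C * ‖X - A‖ := by
  refine (h.norm_sub_le (pos_of_mem_fixedRank hm hr hA) hA).trans_lt ?_
  rw [contractionFactor, mul_assoc]
  exact mul_lt_mul_of_pos_left (norm_gradientStep_sub_lt hm hr hA hδ hC hX hXA) (by positivity)

theorem IsRGDStep.eq_of_eq {X' : Tensor n} (hn : ∀ i, 0 < n i) (hA : A ∈ fixedRank n r)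
    (h : IsRGDStep R r A A X') : X' = A := by
  have h1 := h.norm_sub_le hn hA
  have h2 : riemannianGradient R r A A = 0 := by simp [riemannianGradient]
  rw [h2, smul_zero, sub_zero, sub_self, norm_zero, mul_zero] at h1
  exact sub_eq_zero.1 (norm_le_zero_iff.1 h1)

end RGD

end TensorTrain

end

/-! ### Assembly: the one-step bound and its iteration -/

/-- Tensors have order `d = m + 1 ≥ 2`, so that `√m` stands for `√(d - 1)`. -/
theorem mainTheorem6 {m : ℕ} (hm : 0 < m) (n : Fin (m + 1) → ℕ) (r : Fin m → ℕ)
    (hr : ∀ k, 0 < r k) {s : ℕ} (R : TensorTrain.Tensor n →L[ℝ] EuclideanSpace ℝ (Fin s))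
    (A : TensorTrain.Tensor n) (hA : A ∈ TensorTrain.fixedRank n r)
    (δ : ℝ) (hδ : TensorTrain.HasRIP R (fun k => 2 * r k) δ)
    (C : ℝ)
    (hC : ‖(ContinuousLinearMap.adjoint R).comp R‖ ≤ C ∨
      ∃ δ₃ : ℝ, TensorTrain.HasRIP R (fun k => 3 * r k) δ₃ ∧ C = 1 + δ₃) :
    (∀ X ∈ TensorTrain.fixedRank n r, ∀ X' : TensorTrain.Tensor n,
      TensorTrain.IsRGDStep R r A X X' →
        ‖X' - A‖ ≤ TensorTrain.contractionFactor A X δ C * ‖X - A‖) ∧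
    (δ < (3 + 2 * √(m : ℝ))⁻¹ →
      ∀ X₀ ∈ TensorTrain.fixedRank n r,
        ‖X₀ - A‖ / TensorTrain.sigmaMin A <
          1 / (1 + C - δ) * ((1 - δ) / (1 + √(m : ℝ)) - 2 * δ) →
        TensorTrain.contractionFactor A X₀ δ C < 1 ∧
        ∀ X : ℕ → TensorTrain.Tensor n, X 0 = X₀ →
          (∀ t, X t ∈ TensorTrain.fixedRank n r) →
          (∀ t, TensorTrain.IsRGDStep R r A (X t) (X (t + 1))) →
          ∀ t, ‖X (t + 1) - A‖ ≤
              TensorTrain.contractionFactor A X₀ δ C ^ (t + 1) * ‖X₀ - A‖ ∧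
            (X₀ ≠ A → ‖X (t + 1) - A‖ <
              TensorTrain.contractionFactor A X₀ δ C ^ (t + 1) * ‖X₀ - A‖)) := by
  open TensorTrain in
  have hC₀ := nonneg_of_bound hC
  have hδ₀ : 0 < δ := hδ.1
  have h1δ : 0 < 1 - δ := sub_pos.2 hδ.2.1
  have hn := pos_of_mem_fixedRank hm hr hA
  have hσ : 0 < sigmaMin A := sigmaMin_pos hm fun k => by rw [hA k]; exact hr k
  have hstep : ∀ X ∈ fixedRank n r, ∀ X' : Tensor n, IsRGDStep R r A X X' →
      ‖X' - A‖ ≤ contractionFactor A X δ C * ‖X - A‖ := fun X hX X' h => by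
    rcases eq_or_ne X A with rfl | hne
    · rw [h.eq_of_eq hn hA]; simp
    · exact (h.norm_sub_lt hm hr hA hδ hC hX hne).le
  -- Errors never grow along the iteration, so by monotonicity each later factor is at most the
  -- initial one.
  have hmono : ∀ X Z : Tensor n, ‖X - A‖ ≤ ‖Z - A‖ →
      contractionFactor A X δ C ≤ contractionFactor A Z δ C := fun X Z h => by
    unfold contractionFactor
    gcongr
  have hpos : ∀ X : Tensor n, 0 < contractionFactor A X δ C := fun X => by
    unfold contractionFactor
    positivity
  refine ⟨hstep, fun _ X₀ _ hinit => ?_⟩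
  have hβ : contractionFactor A X₀ δ C < 1 := by
    have h1 : 0 < 1 + C - δ := by linarith
    have h2 : 0 < 1 + √(m : ℝ) := by positivity
    rw [one_div_mul_eq_div, lt_div_iff₀ h1, lt_sub_iff_add_lt, lt_div_iff₀ h2] at hinit
    have h3 : contractionFactor A X₀ δ C =
        (‖X₀ - A‖ / sigmaMin A * (1 + C - δ) + 2 * δ) * (1 + √(m : ℝ)) / (1 - δ) := by
      unfold contractionFactor
      field_simp
      ring
    rw [h3, div_lt_one h1δ]
    exact hinit
  refine ⟨hβ, fun X hX0 hX hstepX => ?_⟩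
  subst hX0
  set β := contractionFactor A (X 0) δ C with hβdef
  have hβ₀ : 0 < β := hpos _
  have hle : ∀ t, ‖X t - A‖ ≤ β ^ t * ‖X 0 - A‖ := by
    intro t
    induction t with
    | zero => simp
    | succ t ih =>
      have h1 : ‖X t - A‖ ≤ ‖X 0 - A‖ := ih.trans
        (mul_le_of_le_one_left (norm_nonneg _) (pow_le_one₀ hβ₀.le hβ.le))
      calc ‖X (t + 1) - A‖ ≤ contractionFactor A (X t) δ C * ‖X t - A‖ :=
            hstep _ (hX t) _ (hstepX t)
        _ ≤ β * (β ^ t * ‖X 0 - A‖) := mul_le_mul (hmono _ _ h1) ih (norm_nonneg _) hβ₀.le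
        _ = β ^ (t + 1) * ‖X 0 - A‖ := by ring
  refine fun t => ⟨hle (t + 1), fun hne => ?_⟩
  -- The iteration may hit `A` exactly; it then stays there, and strictness follows from positivity
  -- of `β` and of the initial error.
  rcases eq_or_ne (X t) A with h0 | h0
  · have h1 := hstepX t
    rw [h0] at h1
    rw [h1.eq_of_eq hn hA, sub_self, norm_zero]
    exact mul_pos (pow_pos hβ₀ _) (norm_pos_iff.2 (sub_ne_zero.2 hne))
  · have h1 : ‖X t - A‖ ≤ ‖X 0 - A‖ := (hle t).trans
      (mul_le_of_le_one_left (norm_nonneg _) (pow_le_one₀ hβ₀.le hβ.le))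
    calc ‖X (t + 1) - A‖ < contractionFactor A (X t) δ C * ‖X t - A‖ :=
          (hstepX t).norm_sub_lt hm hr hA hδ hC (hX t) h0
      _ ≤ β * (β ^ t * ‖X 0 - A‖) :=
          mul_le_mul (hmono _ _ h1) (hle t) (norm_nonneg _) hβ₀.le
      _ = β ^ (t + 1) * ‖X 0 - A‖ := by ring
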